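/- **Obstruction tensor at null infinity.** Let $n\ge 4$ be even, let $S$ be a smooth $n$-dimensional manifold and $h$ a smooth pseudo-Riemannian metric on $S$. Consider a straight ambient metric $$g = 2\rho\,dt^2 + 2t\,dt\,d\rho + t^2\mu(\rho),\qquad t>0,$$ where $\mu(\rho)=\mu_{AB}(\rho,x)\,dx^A dx^B$ is a family of pseudo-Riemannian metrics, smooth in $(\rho,x)$ on a neighbourhood of $\{0\}\times S$ in $\mathbb R\times S$, with $\mu(0)=h$. Assume that $g$ solves the vacuum Einstein equations to order $n/2-2$: the components $R_{\alpha\beta}$ of its Ricci tensor in coordinates $(t,\rho,x^A)$ satisfy $\partial_\rho^m R_{\alpha\beta}|_{\rho=0}=0$ for all $0\le m\le n/2-2$. *Obstruction tensor.* Put $\mu^{(0)}=h$. For a given $m\ge 0$, if $\mu^{(0)},\dots,\mu^{(m)}$ are known, let $\mathcal L^{(m)}_{AB}$ be the value at $\rho=0$ of $\partial_\rho^m R_{AB}$ for the straight ambient metric with $\mu=\sum_{k\le m}\frac{\rho^k}{k!}\mu^{(k)}$ (it does not depend on $t$), and for $m\le n/2-2$ let $\mu^{(m+1)}$ be the unique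 solution of $$\Big(m+1-\frac n2\Big)\mu^{(m+1)}_{AB}-\frac12\big(h^{CD}\mu^{(m+1)}_{CD}\big)h_{AB}+\mathcal L^{(m)}_{AB}=0,$$ that is, the coefficient for which $\partial_\rho^m R_{AB}|_{\rho=0}=0$. The Fefferman–Graham obstruction tensor of $h$ is $\mathcal O_{AB}=\big(\mathcal L^{(n/2-1)}_{AB}\big)^{TF}$. Here and below, TF is the trace-free part with respect to $h$. *Conformal completion.* With $v=t^{-1}$ and $u=\rho t$, the metric $\widetilde g=v^2g=-2\,du\,dv+\mu(uv)$ extends smoothly to null infinity $\mathscr J=\{v=0\}$. Let $$\mathcal Q=\operatorname{Hess}_{\widetilde g}v+v\operatorname{Sch}_{\widetilde g},\qquad \operatorname{Sch}_{\widetilde g}=\frac1n\Big(\operatorname{Ric}_{\widetilde g}-\frac{\operatorname{Scal}_{\widetilde g}}{2(n+1)}\widetilde g\Big).$$ Then, in the coordinates $(u,v,x^A)$ given by any chart of $S$, at every $x$ in the chart and every $u\in\mathbb R$, $$\Big(\frac n2-1\Big)!\;\mathcal O_{AB}=2\,\partial_u^{n/2-1}\Big(\big(\partial_v^{n/2}\mathcal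 Q_{AB}\big)\big|_{v=0}\Big)^{TF}.$$ Consequently, if $\mathcal O\neq0$ at $x$, then at every point $(u,0,x)$ of $\mathscr J$ with $u\neq0$ the tensor $(\partial_v^{n/2}\mathcal Q_{AB})^{TF}$, and hence also $\partial_v^{n/2}\mathcal Q_{AB}$, is nonzero. Moreover, with $\mathfrak s=\frac1{n+2}\operatorname{tr}_{\widetilde g}\mathcal Q$, the tensor $\partial_v^{n/2}(\mathcal Q-\mathfrak s\,\widetilde g)_{AB}$ is nonzero at these points. So the conformal Einstein equations, in the form $\mathcal Q=0$ as well as in the form $\operatorname{Hess}_{\widetilde g}v+v\operatorname{Sch}_{\widetilde g}-\mathfrak s\,\widetilde g=0$, fail at $\mathscr J$ at that order. -/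

import Mathlib

open scoped Manifold ContDiff

noncomputable section

namespace AmbientNullInfinity

/-! ### Curvature of a (pseudo-Riemannian) metric in a coordinate system -/

section Curvature

variable {ι : Type} [Fintype ι] [DecidableEq ι]

/-- The partial derivative `∂ᵢ f` at `p`. -/
def pd (i : ι) (f : (ι → ℝ) → ℝ) (p : ι → ℝ) : ℝ := fderiv ℝ f p (Pi.single i 1)

/-- The Christoffel symbols `Γᵏᵢⱼ = ½ gᵏˡ (∂ᵢ gₗⱼ + ∂ⱼ gₗᵢ - ∂ₗ gᵢⱼ)`. -/
def christoffel (g : (ι → ℝ) → Matrix ι ι ℝ) (k i j : ι) (p : ι → ℝ) : ℝ :=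
  (1 / 2) * ∑ l, (g p)⁻¹ k l *
    (pd i (fun q => g q l j) p + pd j (fun q => g q l i) p - pd l (fun q => g q i j) p)

/-- The Ricci tensor `Rᵢⱼ = ∂ₖ Γᵏᵢⱼ - ∂ⱼ Γᵏᵢₖ + Γᵏₖₗ Γˡᵢⱼ - Γᵏⱼₗ Γˡᵢₖ`
(positive on round spheres). -/
def ricci (g : (ι → ℝ) → Matrix ι ι ℝ) (p : ι → ℝ) : Matrix ι ι ℝ :=
  Matrix.of fun i j =>
    (∑ k, (pd k (christoffel g k i j) p - pd j (christoffel g k i k) p)) +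
      ∑ k, ∑ l, (christoffel g k k l p * christoffel g l i j p -
        christoffel g k j l p * christoffel g l i k p)

/-- The scalar curvature `gⁱʲ Rᵢⱼ`. -/
def scal (g : (ι → ℝ) → Matrix ι ι ℝ) (p : ι → ℝ) : ℝ :=
  ∑ i, ∑ j, (g p)⁻¹ i j * ricci g p i j

/-- The Schouten tensor `(Ric - Scal / (2 (d - 1)) g) / (d - 2)`, where `d` is the dimension. -/
def schouten (g : (ι → ℝ) → Matrix ι ι ℝ) (p : ι → ℝ) : Matrix ι ι ℝ :=
  (1 / ((Fintype.card ι : ℝ) - 2)) •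
    (ricci g p - (scal g p / (2 * ((Fintype.card ι : ℝ) - 1))) • g p)

/-- The Hessian `∇ᵢ ∇ⱼ f = ∂ᵢ ∂ⱼ f - Γᵏᵢⱼ ∂ₖ f`. -/
def hess (g : (ι → ℝ) → Matrix ι ι ℝ) (f : (ι → ℝ) → ℝ) (p : ι → ℝ) : Matrix ι ι ℝ :=
  Matrix.of fun i j => pd i (pd j f) p - ∑ k, christoffel g k i j p * pd k f p

/-- The tensor `𝒬 = Hess_g Ω + Ω Sch_g`. -/
def Q (g : (ι → ℝ) → Matrix ι ι ℝ) (Ω : (ι → ℝ) → ℝ) (p : ι → ℝ) : Matrix ι ι ℝ :=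
  hess g Ω p + Ω p • schouten g p

/-- The left-hand side `Hess_g Ω + Ω Sch_g - 𝔰 g` of the conformal Einstein (quasi-Einstein)
equations, where `𝔰 = d⁻¹ (□_g Ω + Ω tr_g Sch_g) = d⁻¹ tr_g 𝒬`. -/
def quasiEinstein (g : (ι → ℝ) → Matrix ι ι ℝ) (Ω : (ι → ℝ) → ℝ) (p : ι → ℝ) : Matrix ι ι ℝ :=
  Q g Ω p - ((1 / (Fintype.card ι : ℝ)) * ∑ i, ∑ j, (g p)⁻¹ i j * Q g Ω p i j) • g p

end Curvature

/-! ### The straight ambient metric, its conformal completion and the obstruction tensor, in a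
coordinate chart of the `n`-dimensional base -/

section Ambient

variable {n : ℕ}

/-- The trace `hᴬᴮ M_AB` of `M` with respect to `h`. -/
def tr (h M : Matrix (Fin n) (Fin n) ℝ) : ℝ := ∑ A, ∑ B, h⁻¹ A B * M A B

/-- The trace-free part of `M` with respect to `h`. -/
def TF (h M : Matrix (Fin n) (Fin n) ℝ) : Matrix (Fin n) (Fin n) ℝ := M - (tr h M / n) • h

/-- The point with coordinates `(a, b, y¹, …, yⁿ)`. -/
def pt (a b : ℝ) (y : Fin n → ℝ) : Fin 2 ⊕ Fin n → ℝ := Sum.elim ![a, b] y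

/-- The straight ambient metric `g = 2 ρ dt² + 2 t dt dρ + t² μ(ρ, y)` in the coordinates
`(t, ρ, y)`. -/
def ambientMetric (μ : ℝ → (Fin n → ℝ) → Matrix (Fin n) (Fin n) ℝ)
    (p : Fin 2 ⊕ Fin n → ℝ) : Matrix (Fin 2 ⊕ Fin n) (Fin 2 ⊕ Fin n) ℝ :=
  let t := p (Sum.inl 0)
  let ρ := p (Sum.inl 1)
  let y := fun A => p (Sum.inr A)
  Matrix.fromBlocks !![2 * ρ, t; t, 0] 0 0 (t ^ 2 • μ ρ y)

/-- The conformally rescaled metric `g̃ = v² g = -2 du dv + μ(uv, y)` in the coordinates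
`(u, v, y)`, `u = ρ t`, `v = t⁻¹`, extended to `{v = 0}`. -/
def conformalMetric (μ : ℝ → (Fin n → ℝ) → Matrix (Fin n) (Fin n) ℝ)
    (p : Fin 2 ⊕ Fin n → ℝ) : Matrix (Fin 2 ⊕ Fin n) (Fin 2 ⊕ Fin n) ℝ :=
  let u := p (Sum.inl 0)
  let v := p (Sum.inl 1)
  let y := fun A => p (Sum.inr A)
  Matrix.fromBlocks !![0, -1; -1, 0] 0 0 (μ (u * v) y)

/-- The conformal factor `Ω = v`. -/
def conformalFactor (p : Fin 2 ⊕ Fin n → ℝ) : ℝ := p (Sum.inl 1)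

/-- The tangential components `∂_ρ^m R_AB` of the `m`-th `ρ`-derivative of the Ricci tensor of the
ambient metric at `ρ = 0` (they do not depend on `t`, and are computed at `t = 1`). -/
def ricciJet (μ : ℝ → (Fin n → ℝ) → Matrix (Fin n) (Fin n) ℝ) (m : ℕ) (y : Fin n → ℝ) :
    Matrix (Fin n) (Fin n) ℝ :=
  Matrix.of fun A B =>
    iteratedDeriv m (fun ρ => ricci (ambientMetric μ) (pt 1 ρ y) (Sum.inr A) (Sum.inr B)) 0

/-- The solution `X` of `(m + 1 - n/2) X - ½ (tr_h X) h + L = 0`. -/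
def nextCoeff (m : ℕ) (h L : Matrix (Fin n) (Fin n) ℝ) : Matrix (Fin n) (Fin n) ℝ :=
  (1 / ((n : ℝ) / 2 - m - 1)) • (L - (tr h L / (2 * ((n : ℝ) - m - 1))) • h)

/-- The polynomial `∑_{k ≤ m} μ⁽ᵏ⁾ ρᵏ / k!`, whose coefficients are determined recursively by `h`:
`μ⁽⁰⁾ = h`, and, with `𝓛⁽ᵐ⁾_AB` the value at `ρ = 0` of `∂_ρ^m R_AB` of the ambient metric of
`∑_{k ≤ m} μ⁽ᵏ⁾ ρᵏ / k!`, the coefficient `μ⁽ᵐ⁺¹⁾` is the one that makes `∂_ρ^m R_AB` vanish at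
`ρ = 0`, i.e. the solution of
`0 = ∂_ρ^m R_AB = (m + 1 - n/2) μ⁽ᵐ⁺¹⁾_AB - ½ (hᶜᴰ μ⁽ᵐ⁺¹⁾_CD) h_AB + 𝓛⁽ᵐ⁾_AB`.
For even `n` only the orders `m < n/2` are meaningful. -/
def expansion (h : (Fin n → ℝ) → Matrix (Fin n) (Fin n) ℝ) :
    ℕ → ℝ → (Fin n → ℝ) → Matrix (Fin n) (Fin n) ℝ
  | 0 => fun _ y => h y
  | m + 1 => fun ρ y =>
      expansion h m ρ y +
        (ρ ^ (m + 1) / ((m + 1).factorial : ℝ)) • nextCoeff m (h y) (ricciJet (expansion h m) m y)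

/-- The Fefferman–Graham obstruction tensor `𝒪_AB` of `h` for even `n ≥ 4`, normalised as
`(𝓛⁽ᵐ⁾_AB)^TF` with `m = n/2 - 1`. This is the trace-free part of `∂_ρ^m R_AB` at `ρ = 0`: the
next coefficient `μ⁽ᵐ⁺¹⁾` enters `∂_ρ^m R_AB` only through its trace. -/
def obstruction (h : (Fin n → ℝ) → Matrix (Fin n) (Fin n) ℝ) (y : Fin n → ℝ) :
    Matrix (Fin n) (Fin n) ℝ :=
  TF (h y) (ricciJet (expansion h (n / 2 - 1)) (n / 2 - 1) y)

end Ambient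

/-! ### Straight ambient metrics over a smooth manifold -/

section Manifold

variable {n : ℕ} {S : Type*} [TopologicalSpace S] [ChartedSpace (Fin n → ℝ) S]

/-- Fields of bilinear forms on the tangent spaces of the `n`-dimensional manifold `S`. -/
abbrev BilinField (n : ℕ) (S : Type*) [TopologicalSpace S] [ChartedSpace (Fin n → ℝ) S] : Type _ :=
  ∀ x : S, TangentSpace 𝓘(ℝ, Fin n → ℝ) x →L[ℝ] TangentSpace 𝓘(ℝ, Fin n → ℝ) x →L[ℝ] ℝ

/-- The coordinate vector `∂_A` of the chart `e` at the point with coordinates `y`. -/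
def coordVec (e : OpenPartialHomeomorph S (Fin n → ℝ)) (y : Fin n → ℝ) (A : Fin n) :
    TangentSpace 𝓘(ℝ, Fin n → ℝ) (e.symm y) :=
  mfderiv 𝓘(ℝ, Fin n → ℝ) 𝓘(ℝ, Fin n → ℝ) e.symm y (Pi.single A (1 : ℝ) : Fin n → ℝ)

/-- The components `b_AB` of `b` in the chart `e`, as functions of the coordinates. -/
def components (e : OpenPartialHomeomorph S (Fin n → ℝ)) (b : BilinField n S) (y : Fin n → ℝ) :
    Matrix (Fin n) (Fin n) ℝ :=
  Matrix.of fun A B => b (e.symm y) (coordVec e y A) (coordVec e y B)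

/-- `μ(ρ, ·)` is a smooth family of pseudo-Riemannian metrics (of any signature), defined for
`(ρ, x)` in the open neighbourhood `W` of `{0} × S` in `ℝ × S`, with `μ(0, ·) = h`. Equivalently,
`2 ρ dt² + 2 t dt dρ + t² μ` is a smooth metric on `{(t, ρ, x) : t > 0, (ρ, x) ∈ W}` whose pullback
to `ρ = 0` is `t² h`. -/
structure IsStraightAmbient (h : BilinField n S) (W : Set (ℝ × S)) (μ : ℝ → BilinField n S) :
    Prop where
  isOpen : IsOpen W
  zero_mem : ∀ x : S, ((0 : ℝ), x) ∈ W
  symm : ∀ ρ x, (ρ, x) ∈ W → ∀ X Y, μ ρ x X Y = μ ρ x Y X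
  nondegenerate : ∀ ρ x, (ρ, x) ∈ W → ∀ X, (∀ Y, μ ρ x X Y = 0) → X = 0
  smooth : ∀ e ∈ IsManifold.maximalAtlas 𝓘(ℝ, Fin n → ℝ) ∞ S, ∀ A B : Fin n,
    ContDiffOn ℝ ∞ (fun q : ℝ × (Fin n → ℝ) => components e (μ q.1) q.2 A B)
      {q | q.2 ∈ e.target ∧ (q.1, e.symm q.2) ∈ W}
  initial : μ 0 = h

/-- The ambient metric of `μ` solves the Einstein equations up to and including the order `N`:
in every chart, `∂_ρ^m R_αβ = 0` at `ρ = 0` for all `m ≤ N` and all indices `α, β`. -/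
def SolvedToOrder (μ : ℝ → BilinField n S) (N : ℕ) : Prop :=
  ∀ e ∈ IsManifold.maximalAtlas 𝓘(ℝ, Fin n → ℝ) ∞ S, ∀ y ∈ e.target, ∀ t : ℝ, 0 < t →
    ∀ m ≤ N, ∀ α β : Fin 2 ⊕ Fin n,
      iteratedDeriv m
        (fun ρ => ricci (ambientMetric fun r => components e (μ r)) (pt t ρ y) α β) 0 = 0

/-- The components `∂_v^k 𝒬_AB` at the point `(u, v = 0, y)` of null infinity, where
`𝒬 = Hess_g̃ v + v Sch_g̃` is computed for `g̃ = -2 du dv + μ(uv, y)`. -/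
def QJet (μ : ℝ → (Fin n → ℝ) → Matrix (Fin n) (Fin n) ℝ) (k : ℕ) (u : ℝ) (y : Fin n → ℝ) :
    Matrix (Fin n) (Fin n) ℝ :=
  Matrix.of fun A B =>
    iteratedDeriv k
      (fun v => Q (conformalMetric μ) conformalFactor (pt u v y) (Sum.inr A) (Sum.inr B)) 0

/-- The same for the full conformal Einstein expression `Hess_g̃ v + v Sch_g̃ - 𝔰 g̃`. -/
def quasiEinsteinJet (μ : ℝ → (Fin n → ℝ) → Matrix (Fin n) (Fin n) ℝ) (k : ℕ) (u : ℝ)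
    (y : Fin n → ℝ) : Matrix (Fin n) (Fin n) ℝ :=
  Matrix.of fun A B =>
    iteratedDeriv k
      (fun v => quasiEinstein (conformalMetric μ) conformalFactor (pt u v y)
        (Sum.inr A) (Sum.inr B)) 0

end Manifold

end AmbientNullInfinity

end

/-! The whole statement reduces to functions of `(ρ, y)` in one chart. Write `μ'` for `∂_ρ μ` and `k
= n/2 - 1`. For the straight ambient metric the tangential Ricci components do not depend on `t`;
they are given by `ambientRicci`, whose terms of highest order in `ρ` are `ρ μ'' + (1 - n/2) μ' - ½
tr(μ⁻¹μ') μ`, the other terms being the Ricci tensor of `μ(ρ)` and `ρ` times quadratic terms in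
`μ'`.

Obstruction. Apply `∂_ρ^m` at `ρ = 0` and ask how the Taylor coefficient `μ⁽ᵐ⁺¹⁾` enters: `ρ μ''`
yields `m`, the next term `1 - n/2`, and the last one a multiple of `h`; everything else sees only
coefficients of order `≤ m`. This is `rhoDeriv_iterate_ambientRicci_sub`. While `m < k` the
resulting linear equation has a unique solution, so the Einstein equations force the Taylor
coefficients of `μ` to be those of `expansion` (`isTaylorPoly_expansion`). At `m = k` the factor `m
+ 1 - n/2` is zero, the unknown coefficient contributes only a multiple of `h`, and the trace-free
part of `∂_ρ^k R_AB` is the obstruction tensor (`obstruction_eq_TF`).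

Null infinity. The tensor `𝒬` is conformally covariant: as `g = v⁻² g̃`, it equals `v Sch_g`.
Explicitly, `𝒬_AB = (v/n) (R_AB - c Scal μ_AB)` with `R_AB` and `Scal` (the latter scaled by `t²`)
evaluated at `ρ = uv` (`Q_conformalMetric_inr`). Removing the trace part `𝔰 g̃` only changes the
constant `c` (`quasiEinstein_conformalMetric_inr`). A function `v f(uv)` has `(k+1)`-st
`v`-derivative `(k+1) u^k f⁽ᵏ⁾(0)` at `v = 0`, and `(k+1)/n = ½`. The derivatives of `Scal` of order
`< k` vanish at `ρ = 0`, so its term is a multiple of `h` (`IsRicciFlatTo.iteratedDeriv_eq`). Hence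
in both cases the trace-free part of the `n/2`-th `v`-derivative is `½ u^k 𝒪_AB`. Its `k`-th
`u`-derivative gives the identity with `k!`, and it is nonzero where `𝒪 ≠ 0` and `u ≠ 0`. -/

noncomputable section

namespace AmbientNullInfinity

/-! ### Directional derivatives of smooth functions on open sets -/

section DirDeriv

variable {E : Type*} [NormedAddCommGroup E] [NormedSpace ℝ E] {U : Set E}

/-- The derivative of `f` in the direction `v`. -/
def dirDeriv (v : E) (f : E → ℝ) (x : E) : ℝ := fderiv ℝ f x v

theorem _root_.ContDiffOn.differentiableAt_of_isOpen {f : E → ℝ} (hf : ContDiffOn ℝ ∞ f U)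
    (hU : IsOpen U) {x : E} (hx : x ∈ U) : DifferentiableAt ℝ f x :=
  (hf.contDiffAt (hU.mem_nhds hx)).differentiableAt (by simp)

theorem _root_.ContDiffOn.dirDeriv {f : E → ℝ} (hf : ContDiffOn ℝ ∞ f U) (hU : IsOpen U) (v : E) :
    ContDiffOn ℝ ∞ (dirDeriv v f) U :=
  (hf.fderiv_of_isOpen hU (by simp)).clm_apply contDiffOn_const

theorem dirDeriv_congr (hU : IsOpen U) {f g : E → ℝ} (h : Set.EqOn f g U) (v : E) :
    Set.EqOn (dirDeriv v f) (dirDeriv v g) U := fun x hx => by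
  have : f =ᶠ[nhds x] g := Filter.eventuallyEq_of_mem (hU.mem_nhds hx) h
  simp only [dirDeriv, this.fderiv_eq]

theorem dirDeriv_iterate_congr (hU : IsOpen U) {f g : E → ℝ} (h : Set.EqOn f g U) (v : E) (k : ℕ) :
    Set.EqOn ((dirDeriv v)^[k] f) ((dirDeriv v)^[k] g) U := by
  induction k generalizing f g with
  | zero => exact h
  | succ k ih => exact ih (dirDeriv_congr hU h v)

theorem _root_.ContDiffOn.dirDeriv_iterate {f : E → ℝ} (hf : ContDiffOn ℝ ∞ f U) (hU : IsOpen U)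
    (v : E) (k : ℕ) : ContDiffOn ℝ ∞ ((AmbientNullInfinity.dirDeriv v)^[k] f) U := by
  induction k generalizing f with
  | zero => exact hf
  | succ k ih => exact ih (hf.dirDeriv hU v)

theorem dirDeriv_const (v : E) (c : ℝ) : dirDeriv v (fun _ => c) = fun _ => 0 := by
  funext x; simp [dirDeriv]

theorem dirDeriv_add (v : E) {f g : E → ℝ} {x : E} (hf : DifferentiableAt ℝ f x)
    (hg : DifferentiableAt ℝ g x) :
    dirDeriv v (fun z => f z + g z) x = dirDeriv v f x + dirDeriv v g x := by
  simp only [dirDeriv]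
  rw [show (fun z => f z + g z) = f + g from rfl, fderiv_add hf hg]; rfl

theorem dirDeriv_mul (v : E) {f g : E → ℝ} {x : E} (hf : DifferentiableAt ℝ f x)
    (hg : DifferentiableAt ℝ g x) :
    dirDeriv v (fun z => f z * g z) x = dirDeriv v f x * g x + f x * dirDeriv v g x := by
  simp only [dirDeriv]
  rw [show (fun z => f z * g z) = f * g from rfl, fderiv_mul hf hg]
  simp; ring

theorem dirDeriv_const_mul (v : E) (c : ℝ) {f : E → ℝ} {x : E} (hf : DifferentiableAt ℝ f x) :
    dirDeriv v (fun z => c * f z) x = c * dirDeriv v f x := by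
  rw [dirDeriv_mul v (differentiableAt_const c) hf, dirDeriv_const]; simp

theorem dirDeriv_sum (v : E) {κ : Type*} (s : Finset κ) {f : κ → E → ℝ} {x : E}
    (hf : ∀ i ∈ s, DifferentiableAt ℝ (f i) x) :
    dirDeriv v (fun z => ∑ i ∈ s, f i z) x = ∑ i ∈ s, dirDeriv v (f i) x := by
  simp only [dirDeriv]
  rw [fderiv_fun_sum hf]; simp

theorem dirDeriv_comm (hU : IsOpen U) {f : E → ℝ} (hf : ContDiffOn ℝ ∞ f U) (v w : E) {x : E}
    (hx : x ∈ U) : dirDeriv v (dirDeriv w f) x = dirDeriv w (dirDeriv v f) x := by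
  have hc : ContDiffAt ℝ ∞ f x := hf.contDiffAt (hU.mem_nhds hx)
  have hs : IsSymmSndFDerivAt ℝ f x := hc.isSymmSndFDerivAt (by
    rw [minSmoothness_of_isRCLikeNormedField]
    exact WithTop.coe_le_coe.2 (le_top : (2 : ℕ∞) ≤ ⊤))
  have hd : DifferentiableAt ℝ (fderiv ℝ f) x :=
    (hc.fderiv_right (m := 1) (by norm_cast)).differentiableAt (by simp)
  have key : ∀ a b : E, dirDeriv a (dirDeriv b f) x = fderiv ℝ (fderiv ℝ f) x a b := fun a b => by
    simp only [dirDeriv]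
    change fderiv ℝ (fun z => (fderiv ℝ f z) b) x a = _
    rw [fderiv_clm_apply hd (differentiableAt_const b)]; simp
  rw [key, key]; exact hs v w

end DirDeriv

/-! ### Taylor coefficients along `ρ = 0` of functions of `(ρ, y)` -/

section Agree

variable {n : ℕ} {U : Set (ℝ × (Fin n → ℝ))}

/-- The derivative `∂_ρ` of functions of `(ρ, y)`. -/
abbrev rhoDeriv : (ℝ × (Fin n → ℝ) → ℝ) → ℝ × (Fin n → ℝ) → ℝ := dirDeriv (1, 0)

/-- The derivative `∂_A` of functions of `(ρ, y)`. -/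
abbrev yDeriv (A : Fin n) : (ℝ × (Fin n → ℝ) → ℝ) → ℝ × (Fin n → ℝ) → ℝ :=
  dirDeriv (0, Pi.single A 1)

theorem rhoDeriv_fst : dirDeriv (1, 0) (fun x : ℝ × (Fin n → ℝ) => x.1) = fun _ => 1 := by
  funext x
  simp only [dirDeriv]
  rw [show (fun x : ℝ × (Fin n → ℝ) => x.1) = Prod.fst from rfl, fderiv_fst]; simp

theorem contDiffOn_rho : ContDiffOn ℝ ∞ (fun x : ℝ × (Fin n → ℝ) => x.1) U :=
  contDiff_fst.contDiffOn

/-- Iterated derivatives in `ρ` at fixed `y` are iterates of `∂_ρ`. -/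
theorem iteratedDeriv_eq_rhoDeriv_iterate (hU : IsOpen U) {f : ℝ × (Fin n → ℝ) → ℝ}
    (hf : ContDiffOn ℝ ∞ f U) (k : ℕ) {ρ : ℝ} {y : Fin n → ℝ} (hx : (ρ, y) ∈ U) :
    iteratedDeriv k (fun r => f (r, y)) ρ = rhoDeriv^[k] f (ρ, y) := by
  induction k generalizing ρ with
  | zero => simp
  | succ k ih =>
    rw [iteratedDeriv_succ, Function.iterate_succ_apply']
    have hO : IsOpen {r : ℝ | (r, y) ∈ U} := hU.preimage (by fun_prop)
    have he : iteratedDeriv k (fun r => f (r, y)) =ᶠ[nhds ρ] fun r => rhoDeriv^[k] f (r, y) :=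
      Filter.eventuallyEq_of_mem (hO.mem_nhds hx) fun r hr => ih hr
    rw [he.deriv_eq]
    have hd := (hf.dirDeriv_iterate hU (1, 0) k).differentiableAt_of_isOpen hU hx
    have hg : HasDerivAt (fun r : ℝ => ((r, y) : ℝ × (Fin n → ℝ))) (1, 0) ρ :=
      (hasDerivAt_id ρ).prodMk (hasDerivAt_const ρ y)
    exact (hd.hasFDerivAt.comp_hasDerivAt ρ hg).deriv

/-- `f` and `g` are smooth on `U` and have the same `ρ`-derivatives of orders `< k` at `ρ = 0`. -/
def AgreeTo (U : Set (ℝ × (Fin n → ℝ))) (k : ℕ) (f g : ℝ × (Fin n → ℝ) → ℝ) : Prop :=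
  ContDiffOn ℝ ∞ f U ∧ ContDiffOn ℝ ∞ g U ∧
    ∀ j < k, ∀ y, (0, y) ∈ U → rhoDeriv^[j] f (0, y) = rhoDeriv^[j] g (0, y)

namespace AgreeTo

variable {k : ℕ} {f g f₁ g₁ f₂ g₂ : ℝ × (Fin n → ℝ) → ℝ}

theorem refl (hf : ContDiffOn ℝ ∞ f U) : AgreeTo U k f f := ⟨hf, hf, fun _ _ _ _ => rfl⟩

theorem mono {l : ℕ} (h : AgreeTo U k f g) (hl : l ≤ k) : AgreeTo U l f g :=
  ⟨h.1, h.2.1, fun j hj => h.2.2 j (hj.trans_le hl)⟩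

theorem congr (hU : IsOpen U) (h : AgreeTo U k f g) (hf : Set.EqOn f₁ f U)
    (hg : Set.EqOn g₁ g U) : AgreeTo U k f₁ g₁ :=
  ⟨h.1.congr hf, h.2.1.congr hg, fun j hj y hy => by
    rw [dirDeriv_iterate_congr hU hf _ j hy, dirDeriv_iterate_congr hU hg _ j hy, h.2.2 j hj y hy]⟩

/-- Peeling off one `∂_ρ` turns the closure properties below into inductions that need only the
first-order sum and product rules, never the full Leibniz formula. -/
theorem succ_iff (hU : IsOpen U) : AgreeTo U (k + 1) f g ↔
    ContDiffOn ℝ ∞ f U ∧ ContDiffOn ℝ ∞ g U ∧ (∀ y, (0, y) ∈ U → f (0, y) = g (0, y)) ∧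
      AgreeTo U k (rhoDeriv f) (rhoDeriv g) := by
  refine ⟨fun h => ⟨h.1, h.2.1, h.2.2 0 k.succ_pos, h.1.dirDeriv hU _, h.2.1.dirDeriv hU _,
    fun j hj => h.2.2 (j + 1) (by omega)⟩, fun h => ⟨h.1, h.2.1, ?_⟩⟩
  rintro (_ | j) hj
  · exact h.2.2.1
  · exact h.2.2.2.2.2 j (by omega)

theorem rhoDeriv (hU : IsOpen U) (h : AgreeTo U (k + 1) f g) :
    AgreeTo U k (rhoDeriv f) (rhoDeriv g) := ((succ_iff hU).1 h).2.2.2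

theorem add (hU : IsOpen U) (h₁ : AgreeTo U k f₁ g₁) (h₂ : AgreeTo U k f₂ g₂) :
    AgreeTo U k (fun x => f₁ x + f₂ x) (fun x => g₁ x + g₂ x) := by
  induction k generalizing f₁ g₁ f₂ g₂ with
  | zero => exact ⟨h₁.1.add h₂.1, h₁.2.1.add h₂.2.1, by simp⟩
  | succ k ih =>
    refine (succ_iff hU).2 ⟨h₁.1.add h₂.1, h₁.2.1.add h₂.2.1, fun y hy => ?_, ?_⟩
    · rw [((succ_iff hU).1 h₁).2.2.1 y hy, ((succ_iff hU).1 h₂).2.2.1 y hy]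
    · exact (ih (h₁.rhoDeriv hU) (h₂.rhoDeriv hU)).congr hU
        (fun x hx => dirDeriv_add _ (h₁.1.differentiableAt_of_isOpen hU hx)
          (h₂.1.differentiableAt_of_isOpen hU hx))
        (fun x hx => dirDeriv_add _ (h₁.2.1.differentiableAt_of_isOpen hU hx)
          (h₂.2.1.differentiableAt_of_isOpen hU hx))

theorem mul (hU : IsOpen U) (h₁ : AgreeTo U k f₁ g₁) (h₂ : AgreeTo U k f₂ g₂) :
    AgreeTo U k (fun x => f₁ x * f₂ x) (fun x => g₁ x * g₂ x) := by
  induction k generalizing f₁ g₁ f₂ g₂ with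
  | zero => exact ⟨h₁.1.mul h₂.1, h₁.2.1.mul h₂.2.1, by simp⟩
  | succ k ih =>
    refine (succ_iff hU).2 ⟨h₁.1.mul h₂.1, h₁.2.1.mul h₂.2.1, fun y hy => ?_, ?_⟩
    · rw [((succ_iff hU).1 h₁).2.2.1 y hy, ((succ_iff hU).1 h₂).2.2.1 y hy]
    · exact ((ih (h₁.rhoDeriv hU) (h₂.mono k.le_succ)).add hU
          (ih (h₁.mono k.le_succ) (h₂.rhoDeriv hU))).congr hU
        (fun x hx => dirDeriv_mul _ (h₁.1.differentiableAt_of_isOpen hU hx)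
          (h₂.1.differentiableAt_of_isOpen hU hx))
        (fun x hx => dirDeriv_mul _ (h₁.2.1.differentiableAt_of_isOpen hU hx)
          (h₂.2.1.differentiableAt_of_isOpen hU hx))

theorem const_mul (hU : IsOpen U) (c : ℝ) (h : AgreeTo U k f g) :
    AgreeTo U k (fun x => c * f x) (fun x => c * g x) :=
  (refl contDiffOn_const).mul hU h

theorem sub (hU : IsOpen U) (h₁ : AgreeTo U k f₁ g₁) (h₂ : AgreeTo U k f₂ g₂) :
    AgreeTo U k (fun x => f₁ x - f₂ x) (fun x => g₁ x - g₂ x) :=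
  (h₁.add hU (h₂.const_mul hU (-1))).congr hU (fun x _ => by simp [sub_eq_add_neg])
    (fun x _ => by simp [sub_eq_add_neg])

theorem sum (hU : IsOpen U) {κ : Type*} {s : Finset κ} {F G : κ → ℝ × (Fin n → ℝ) → ℝ}
    (h : ∀ i ∈ s, AgreeTo U k (F i) (G i)) :
    AgreeTo U k (fun x => ∑ i ∈ s, F i x) (fun x => ∑ i ∈ s, G i x) := by
  classical
  induction s using Finset.induction_on with
  | empty => simpa using refl contDiffOn_const
  | insert a s ha ih =>
    simp only [Finset.sum_insert ha]
    exact (h a (by simp)).add hU (ih fun i hi => h i (by simp [hi]))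

/-- No order is lost: `∂_A` is tangent to the slice `ρ = 0`, so it depends only on the values there,
and it commutes with `∂_ρ`. -/
theorem yDeriv (hU : IsOpen U) (A : Fin n) (h : AgreeTo U k f g) :
    AgreeTo U k (yDeriv A f) (yDeriv A g) := by
  induction k generalizing f g with
  | zero => exact ⟨h.1.dirDeriv hU _, h.2.1.dirDeriv hU _, by simp⟩
  | succ k ih =>
    refine (succ_iff hU).2 ⟨h.1.dirDeriv hU _, h.2.1.dirDeriv hU _, fun y hy => ?_, ?_⟩
    · have h0 := ((succ_iff hU).1 h).2.2.1
      have key : ∀ F : ℝ × (Fin n → ℝ) → ℝ, ContDiffOn ℝ ∞ F U →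
          AmbientNullInfinity.yDeriv A F (0, y) =
            fderiv ℝ (fun z => F (0, z)) y (Pi.single A 1) := fun F hF => by
        have hg : HasFDerivAt (fun z : Fin n → ℝ => ((0, z) : ℝ × (Fin n → ℝ)))
            (ContinuousLinearMap.inr ℝ ℝ (Fin n → ℝ)) y := hasFDerivAt_prodMk_right 0 y
        have := ((hF.differentiableAt_of_isOpen hU hy).hasFDerivAt.comp y hg).fderiv
        rw [show (fun z => F (0, z)) = F ∘ fun z => (0, z) from rfl, this]; rfl
      have hO : IsOpen {z : Fin n → ℝ | ((0 : ℝ), z) ∈ U} := hU.preimage (by fun_prop)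
      have he : (fun z => f (0, z)) =ᶠ[nhds y] fun z => g (0, z) :=
        Filter.eventuallyEq_of_mem (hO.mem_nhds hy) fun z hz => h0 z hz
      rw [key f h.1, key g h.2.1, he.fderiv_eq]
    · exact (ih (h.rhoDeriv hU)).congr hU (fun x hx => dirDeriv_comm hU h.1 _ _ hx)
        (fun x hx => dirDeriv_comm hU h.2.1 _ _ hx)

/-- The factor `ρ` vanishes on the slice, so multiplication by it gains one order. This is what
removes the terms quadratic in `μ'` from the top-order analysis. -/
theorem rho_mul (hU : IsOpen U) (h : AgreeTo U k f g) :
    AgreeTo U (k + 1) (fun x => x.1 * f x) (fun x => x.1 * g x) := by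
  have hd : ∀ F : ℝ × (Fin n → ℝ) → ℝ, ContDiffOn ℝ ∞ F U →
      Set.EqOn (AmbientNullInfinity.rhoDeriv fun x => x.1 * F x)
        (fun x => F x + x.1 * AmbientNullInfinity.rhoDeriv F x) U := fun F hF x hx => by
    refine (dirDeriv_mul _ (contDiffOn_rho.differentiableAt_of_isOpen hU hx)
      (hF.differentiableAt_of_isOpen hU hx)).trans ?_
    rw [rhoDeriv_fst]; simp
  induction k generalizing f g with
  | zero =>
    refine (succ_iff hU).2 ⟨contDiffOn_rho.mul h.1, contDiffOn_rho.mul h.2.1, by simp, ?_⟩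
    exact ⟨(contDiffOn_rho.mul h.1).dirDeriv hU _, (contDiffOn_rho.mul h.2.1).dirDeriv hU _,
      by simp⟩
  | succ k ih =>
    refine (succ_iff hU).2 ⟨contDiffOn_rho.mul h.1, contDiffOn_rho.mul h.2.1, by simp, ?_⟩
    exact (h.add hU (ih (h.rhoDeriv hU))).congr hU (hd f h.1) (hd g h.2.1)

end AgreeTo

theorem rhoDeriv_iterate_add (hU : IsOpen U) {f g : ℝ × (Fin n → ℝ) → ℝ}
    (hf : ContDiffOn ℝ ∞ f U) (hg : ContDiffOn ℝ ∞ g U) (k : ℕ) :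
    Set.EqOn (rhoDeriv^[k] fun x => f x + g x) (fun x => rhoDeriv^[k] f x + rhoDeriv^[k] g x) U := by
  induction k generalizing f g with
  | zero => exact fun _ _ => rfl
  | succ k ih =>
    intro x hx
    exact (dirDeriv_iterate_congr hU (fun z hz => dirDeriv_add _
      (hf.differentiableAt_of_isOpen hU hz) (hg.differentiableAt_of_isOpen hU hz)) _ k hx).trans
      (ih (hf.dirDeriv hU _) (hg.dirDeriv hU _) hx)

theorem rhoDeriv_iterate_const_mul (hU : IsOpen U) {f : ℝ × (Fin n → ℝ) → ℝ}
    (hf : ContDiffOn ℝ ∞ f U) (c : ℝ) (k : ℕ) :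
    Set.EqOn (rhoDeriv^[k] fun x => c * f x) (fun x => c * rhoDeriv^[k] f x) U := by
  induction k generalizing f with
  | zero => exact fun _ _ => rfl
  | succ k ih =>
    intro x hx
    exact (dirDeriv_iterate_congr hU (fun z hz => dirDeriv_const_mul _ c
      (hf.differentiableAt_of_isOpen hU hz)) _ k hx).trans
      (ih (hf.dirDeriv hU _) hx)

theorem rhoDeriv_iterate_sub (hU : IsOpen U) {f g : ℝ × (Fin n → ℝ) → ℝ}
    (hf : ContDiffOn ℝ ∞ f U) (hg : ContDiffOn ℝ ∞ g U) (k : ℕ) :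
    Set.EqOn (rhoDeriv^[k] fun x => f x - g x) (fun x => rhoDeriv^[k] f x - rhoDeriv^[k] g x) U := by
  intro x hx
  have h := rhoDeriv_iterate_add hU hf (contDiffOn_const (c := (-1 : ℝ)) |>.mul hg) k hx
  have h' := rhoDeriv_iterate_const_mul hU hg (-1) k hx
  have e : (fun x => f x - g x) = fun x => f x + (fun _ => (-1 : ℝ)) x * g x := by
    funext z; ring
  rw [e, h]
  simp only at h' ⊢
  rw [h']; ring

theorem rhoDeriv_iterate_sum (hU : IsOpen U) {κ : Type*} (s : Finset κ)
    {f : κ → ℝ × (Fin n → ℝ) → ℝ} (hf : ∀ i ∈ s, ContDiffOn ℝ ∞ (f i) U) (k : ℕ) :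
    Set.EqOn (rhoDeriv^[k] fun x => ∑ i ∈ s, f i x) (fun x => ∑ i ∈ s, rhoDeriv^[k] (f i) x) U := by
  induction k generalizing f with
  | zero => exact fun _ _ => rfl
  | succ k ih =>
    intro x hx
    exact (dirDeriv_iterate_congr hU (fun z hz => dirDeriv_sum _ s
      fun i hi => (hf i hi).differentiableAt_of_isOpen hU hz) _ k hx).trans
      (ih (fun i hi => (hf i hi).dirDeriv hU _) hx)

/-- The top term of the Leibniz rule: lower order derivatives of `f - g` and of `a - b` do not
contribute. -/
theorem AgreeTo.rhoDeriv_iterate_mul_sub (hU : IsOpen U) {k : ℕ}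
    {a b f g : ℝ × (Fin n → ℝ) → ℝ} (ha : AgreeTo U (k + 1) a b) (hf : AgreeTo U k f g)
    {y : Fin n → ℝ} (hy : (0, y) ∈ U) :
    AmbientNullInfinity.rhoDeriv^[k] (fun x => a x * f x) (0, y) -
        AmbientNullInfinity.rhoDeriv^[k] (fun x => b x * g x) (0, y) =
      a (0, y) * (AmbientNullInfinity.rhoDeriv^[k] f (0, y) -
        AmbientNullInfinity.rhoDeriv^[k] g (0, y)) := by
  induction k generalizing a b f g with
  | zero =>
    have := ((succ_iff hU).1 ha).2.2.1 y hy
    simp [this]; ring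
  | succ k ih =>
    simp only [Function.iterate_succ_apply]
    have key : ∀ p q : ℝ × (Fin n → ℝ) → ℝ, ContDiffOn ℝ ∞ p U → ContDiffOn ℝ ∞ q U →
        AmbientNullInfinity.rhoDeriv^[k] (AmbientNullInfinity.rhoDeriv fun x => p x * q x) (0, y) =
        AmbientNullInfinity.rhoDeriv^[k] (fun x => AmbientNullInfinity.rhoDeriv p x * q x) (0, y) +
        AmbientNullInfinity.rhoDeriv^[k] (fun x => p x * AmbientNullInfinity.rhoDeriv q x) (0, y) :=
      fun p q hp hq => by
        exact (dirDeriv_iterate_congr hU (fun z hz => dirDeriv_mul _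
          (hp.differentiableAt_of_isOpen hU hz) (hq.differentiableAt_of_isOpen hU hz)) _ k hy).trans
          (rhoDeriv_iterate_add hU ((hp.dirDeriv hU _).mul hq) (hp.mul (hq.dirDeriv hU _)) k hy)
    rw [key a f ha.1 hf.1, key b g ha.2.1 hf.2.1]
    -- After one product rule, the part in which the derivative falls on `a` agrees with its
    -- counterpart even at order `k`, so it cancels; the other part is the induction hypothesis.
    have h1 := ((ha.rhoDeriv hU).mul hU hf).2.2 k k.lt_succ_self y hy
    have h2 := ih (ha.mono (Nat.le_succ _)) (hf.rhoDeriv hU)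
    linarith

/-- Applied to `f = μ'` at `ρ = 0`, this is the source of the summand `k` in the coefficient `k + 1
- n/2` of `μ⁽ᵏ⁺¹⁾`. -/
theorem rhoDeriv_iterate_rho_mul (hU : IsOpen U) {f : ℝ × (Fin n → ℝ) → ℝ}
    (hf : ContDiffOn ℝ ∞ f U) (k : ℕ) :
    Set.EqOn (rhoDeriv^[k] fun x => x.1 * rhoDeriv f x)
      (fun x => x.1 * rhoDeriv^[k + 1] f x + k * rhoDeriv^[k] f x) U := by
  induction k generalizing f with
  | zero => intro x _; simp
  | succ k ih =>
    intro x hx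
    have hf' : ContDiffOn ℝ ∞ (rhoDeriv f) U := hf.dirDeriv hU _
    have hf'' : ContDiffOn ℝ ∞ (rhoDeriv (rhoDeriv f)) U := hf'.dirDeriv hU _
    have h1 : Set.EqOn (rhoDeriv fun x => x.1 * rhoDeriv f x)
        (fun x => rhoDeriv f x + x.1 * rhoDeriv (rhoDeriv f) x) U := fun z hz => by
      refine (dirDeriv_mul _ (contDiffOn_rho.differentiableAt_of_isOpen hU hz)
        (hf'.differentiableAt_of_isOpen hU hz)).trans ?_
      rw [rhoDeriv_fst]; simp
    rw [Function.iterate_succ_apply, dirDeriv_iterate_congr hU h1 _ k hx,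
      rhoDeriv_iterate_add hU hf' (contDiffOn_rho.mul hf'') k hx]
    have := ih hf' hx
    simp only at this ⊢
    rw [this]
    simp only [Function.iterate_succ_apply]
    push_cast; ring

end Agree

/-! ### The Ricci components of the straight ambient metric as functions of `(ρ, y)` -/

section Components

variable {n : ℕ}

/-- The Christoffel symbols of the metrics `M(ρ, ·)`. -/
def fiberChristoffel (M : ℝ × (Fin n → ℝ) → Matrix (Fin n) (Fin n) ℝ) (C A B : Fin n)
    (x : ℝ × (Fin n → ℝ)) : ℝ :=
  (1 / 2) * ∑ D, (M x)⁻¹ C D *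
    (yDeriv A (fun z => M z D B) x + yDeriv B (fun z => M z D A) x - yDeriv D (fun z => M z A B) x)

/-- The Ricci tensors of the metrics `M(ρ, ·)`. -/
def fiberRicci (M : ℝ × (Fin n → ℝ) → Matrix (Fin n) (Fin n) ℝ) (A B : Fin n)
    (x : ℝ × (Fin n → ℝ)) : ℝ :=
  (∑ C, (yDeriv C (fiberChristoffel M C A B) x - yDeriv B (fiberChristoffel M C A C) x)) +
    ∑ C, ∑ D, (fiberChristoffel M C C D x * fiberChristoffel M D A B x -
      fiberChristoffel M C B D x * fiberChristoffel M D A C x)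

/-- The endomorphism `M⁻¹ ∂_ρ M`. -/
def logDeriv (M : ℝ × (Fin n → ℝ) → Matrix (Fin n) (Fin n) ℝ) (A B : Fin n)
    (x : ℝ × (Fin n → ℝ)) : ℝ :=
  ∑ D, (M x)⁻¹ A D * rhoDeriv (fun z => M z D B) x

/-- The trace of `M⁻¹ ∂_ρ M`. -/
def logDerivTrace (M : ℝ × (Fin n → ℝ) → Matrix (Fin n) (Fin n) ℝ) (x : ℝ × (Fin n → ℝ)) : ℝ :=
  ∑ A, logDeriv M A A x

/-- The components `R_AB` of the Ricci tensor of the straight ambient metric of `M`. -/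
def ambientRicci (M : ℝ × (Fin n → ℝ) → Matrix (Fin n) (Fin n) ℝ) (A B : Fin n)
    (x : ℝ × (Fin n → ℝ)) : ℝ :=
  fiberRicci M A B x + x.1 * rhoDeriv (rhoDeriv fun z => M z A B) x
    - x.1 * (∑ D, rhoDeriv (fun z => M z A D) x * logDeriv M D B x)
    + x.1 * ((1 / 2) * (logDerivTrace M x * rhoDeriv (fun z => M z A B) x))
    + (1 - (n : ℝ) / 2) * rhoDeriv (fun z => M z A B) x
    - (1 / 2) * (M x A B * logDerivTrace M x)

/-- The component `R_ρρ` of the Ricci tensor of the straight ambient metric of `M`. -/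
def ambientRicciRho (M : ℝ × (Fin n → ℝ) → Matrix (Fin n) (Fin n) ℝ) (x : ℝ × (Fin n → ℝ)) : ℝ :=
  -(1 / 2) * rhoDeriv (logDerivTrace M) x - (1 / 4) * ∑ C, ∑ D, logDeriv M C D x * logDeriv M D C x

/-- `M` is a smooth family of metrics on the open set `U` of pairs `(ρ, y)`. -/
structure IsMetricFamily (U : Set (ℝ × (Fin n → ℝ)))
    (M : ℝ × (Fin n → ℝ) → Matrix (Fin n) (Fin n) ℝ) : Prop where
  isOpen : IsOpen U
  smooth : ∀ A B, ContDiffOn ℝ ∞ (fun x => M x A B) U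
  symm : ∀ x ∈ U, ∀ A B, M x A B = M x B A
  det_ne_zero : ∀ x ∈ U, (M x).det ≠ 0

/-! ### Smoothness and Taylor agreement of the curvature components -/

theorem contDiffOn_det {E : Type*} [NormedAddCommGroup E] [NormedSpace ℝ E] {U : Set E}
    {M : E → Matrix (Fin n) (Fin n) ℝ}
    (h : ∀ A B, ContDiffOn ℝ ∞ (fun x => M x A B) U) : ContDiffOn ℝ ∞ (fun x => (M x).det) U := by
  simp only [Matrix.det_apply]
  exact ContDiffOn.sum fun σ _ => (contDiffOn_prod fun i _ => h _ _).const_smul _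

theorem contDiffOn_inv {E : Type*} [NormedAddCommGroup E] [NormedSpace ℝ E] {U : Set E}
    {M : E → Matrix (Fin n) (Fin n) ℝ} (h : ∀ A B, ContDiffOn ℝ ∞ (fun x => M x A B) U)
    (hd : ∀ x ∈ U, (M x).det ≠ 0) (A B : Fin n) : ContDiffOn ℝ ∞ (fun x => (M x)⁻¹ A B) U := by
  simp only [Matrix.inv_def, Ring.inverse_eq_inv', Matrix.smul_apply, smul_eq_mul,
    Matrix.adjugate_apply]
  refine ((contDiffOn_det h).inv hd).mul (contDiffOn_det fun C D => ?_)
  by_cases hC : C = B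
  · subst hC; simpa using contDiffOn_const
  · simpa [Matrix.updateRow_ne hC] using h C D

namespace IsMetricFamily

variable {U : Set (ℝ × (Fin n → ℝ))} {M N : ℝ × (Fin n → ℝ) → Matrix (Fin n) (Fin n) ℝ}

theorem mono {V : Set (ℝ × (Fin n → ℝ))} (h : IsMetricFamily U M) (hV : IsOpen V) (hVU : V ⊆ U) :
    IsMetricFamily V M :=
  ⟨hV, fun A B => (h.smooth A B).mono hVU, fun x hx => h.symm x (hVU hx),
    fun x hx => h.det_ne_zero x (hVU hx)⟩

theorem inv_mul (h : IsMetricFamily U M) {x} (hx : x ∈ U) : (M x)⁻¹ * M x = 1 :=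
  Matrix.nonsing_inv_mul _ (h.det_ne_zero x hx).isUnit

theorem mul_inv (h : IsMetricFamily U M) {x} (hx : x ∈ U) : M x * (M x)⁻¹ = 1 :=
  Matrix.mul_nonsing_inv _ (h.det_ne_zero x hx).isUnit

theorem inv_symm (h : IsMetricFamily U M) {x} (hx : x ∈ U) (A B : Fin n) :
    (M x)⁻¹ A B = (M x)⁻¹ B A := by
  have h1 : (M x).transpose = M x := by ext A B; exact h.symm x hx B A
  have h2 : ((M x)⁻¹).transpose = (M x)⁻¹ := by rw [Matrix.transpose_nonsing_inv, h1]
  exact congrFun (congrFun h2 B) A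

/-- Since `M⁻¹ = M⁻¹ N N⁻¹` and `N⁻¹ = M⁻¹ M N⁻¹`, the two inverses differ only by exchanging the
middle factors `N` and `M`, which agree by hypothesis. -/
theorem agreeTo_inv (hM : IsMetricFamily U M) (hN : IsMetricFamily U N) {k : ℕ}
    (h : ∀ A B, AgreeTo U k (fun x => M x A B) (fun x => N x A B)) (A B : Fin n) :
    AgreeTo U k (fun x => (M x)⁻¹ A B) (fun x => (N x)⁻¹ A B) := by
  have hU := hM.isOpen
  have sI := contDiffOn_inv hM.smooth hM.det_ne_zero
  have sJ := contDiffOn_inv hN.smooth hN.det_ne_zero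
  have key : AgreeTo U k
      (fun x => (M x)⁻¹ A B + ∑ C, ∑ D, (M x)⁻¹ A C * (N x C D * (N x)⁻¹ D B))
      (fun x => (M x)⁻¹ A B + ∑ C, ∑ D, (M x)⁻¹ A C * (M x C D * (N x)⁻¹ D B)) :=
    (AgreeTo.refl (sI A B)).add hU <| AgreeTo.sum hU fun C _ => AgreeTo.sum hU fun D _ =>
      (AgreeTo.refl (sI A C)).mul hU <| AgreeTo.mul hU
        ⟨hN.smooth C D, hM.smooth C D, fun j hj y hy => ((h C D).2.2 j hj y hy).symm⟩
        (AgreeTo.refl (sJ D B))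
  have e1 : ∀ x ∈ U, ∑ C, ∑ D, (M x)⁻¹ A C * (N x C D * (N x)⁻¹ D B) = (M x)⁻¹ A B :=
    fun x hx => by
      have : ((M x)⁻¹ * (N x * (N x)⁻¹)) A B = (M x)⁻¹ A B := by rw [hN.mul_inv hx, mul_one]
      simpa only [Matrix.mul_apply, Finset.mul_sum] using this
  have e2 : ∀ x ∈ U, ∑ C, ∑ D, (M x)⁻¹ A C * (M x C D * (N x)⁻¹ D B) = (N x)⁻¹ A B :=
    fun x hx => by
      have : ((M x)⁻¹ * (M x * (N x)⁻¹)) A B = (N x)⁻¹ A B := by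
        rw [← mul_assoc, hM.inv_mul hx, one_mul]
      simpa only [Matrix.mul_apply, Finset.mul_sum] using this
  have key2 := key.sub hU (AgreeTo.refl (sI A B))
  exact key2.congr hU (fun x hx => by simp [e1 x hx]) (fun x hx => by simp [e2 x hx])

section Agree

variable {k : ℕ}

theorem agreeTo_fiberChristoffel (hM : IsMetricFamily U M) (hN : IsMetricFamily U N)
    (h : ∀ A B, AgreeTo U k (fun x => M x A B) (fun x => N x A B)) (C A B : Fin n) :
    AgreeTo U k (fiberChristoffel M C A B) (fiberChristoffel N C A B) :=
  have hU := hM.isOpen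
  AgreeTo.const_mul hU _ <| AgreeTo.sum hU fun D _ => (hM.agreeTo_inv hN h C D).mul hU <|
    (((h D B).yDeriv hU A).add hU ((h D A).yDeriv hU B)).sub hU ((h A B).yDeriv hU D)

theorem agreeTo_fiberRicci (hM : IsMetricFamily U M) (hN : IsMetricFamily U N)
    (h : ∀ A B, AgreeTo U k (fun x => M x A B) (fun x => N x A B)) (A B : Fin n) :
    AgreeTo U k (fiberRicci M A B) (fiberRicci N A B) :=
  have hU := hM.isOpen
  have c := hM.agreeTo_fiberChristoffel hN h
  (AgreeTo.sum hU fun C _ => ((c C A B).yDeriv hU C).sub hU ((c C A C).yDeriv hU B)).add hU <|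
    AgreeTo.sum hU fun C _ => AgreeTo.sum hU fun D _ =>
      ((c C C D).mul hU (c D A B)).sub hU ((c C B D).mul hU (c D A C))

theorem agreeTo_logDeriv (hM : IsMetricFamily U M) (hN : IsMetricFamily U N)
    (h : ∀ A B, AgreeTo U (k + 1) (fun x => M x A B) (fun x => N x A B)) (A B : Fin n) :
    AgreeTo U k (logDeriv M A B) (logDeriv N A B) :=
  have hU := hM.isOpen
  AgreeTo.sum hU fun D _ => ((hM.agreeTo_inv hN h A D).mono k.le_succ).mul hU ((h D B).rhoDeriv hU)

theorem agreeTo_logDerivTrace (hM : IsMetricFamily U M) (hN : IsMetricFamily U N)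
    (h : ∀ A B, AgreeTo U (k + 1) (fun x => M x A B) (fun x => N x A B)) :
    AgreeTo U k (logDerivTrace M) (logDerivTrace N) :=
  AgreeTo.sum hM.isOpen fun A _ => hM.agreeTo_logDeriv hN h A A

end Agree

/-- `AgreeTo` includes smoothness of both functions, so comparing `M` with itself already yields the
smoothness of this and the following expressions. -/
theorem contDiffOn_fiberRicci (hM : IsMetricFamily U M) (A B : Fin n) :
    ContDiffOn ℝ ∞ (fiberRicci M A B) U :=
  (hM.agreeTo_fiberRicci hM (k := 0) (fun A B => .refl (hM.smooth A B)) A B).1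

theorem contDiffOn_fiberChristoffel (hM : IsMetricFamily U M) (C A B : Fin n) :
    ContDiffOn ℝ ∞ (fiberChristoffel M C A B) U :=
  (hM.agreeTo_fiberChristoffel hM (k := 0) (fun A B => .refl (hM.smooth A B)) C A B).1

theorem contDiffOn_logDeriv (hM : IsMetricFamily U M) (A B : Fin n) :
    ContDiffOn ℝ ∞ (logDeriv M A B) U :=
  (hM.agreeTo_logDeriv hM (k := 0) (fun A B => .refl (hM.smooth A B)) A B).1

theorem contDiffOn_logDerivTrace (hM : IsMetricFamily U M) :
    ContDiffOn ℝ ∞ (logDerivTrace M) U :=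
  (hM.agreeTo_logDerivTrace hM (k := 0) (fun A B => .refl (hM.smooth A B))).1

theorem contDiffOn_ambientRicci (hM : IsMetricFamily U M) (A B : Fin n) :
    ContDiffOn ℝ ∞ (ambientRicci M A B) U := by
  have s := fun A B => (hM.smooth A B).dirDeriv hM.isOpen (1, 0)
  have t := hM.contDiffOn_logDerivTrace
  refine ContDiffOn.sub (ContDiffOn.add (ContDiffOn.add (ContDiffOn.sub (ContDiffOn.add
    (hM.contDiffOn_fiberRicci A B) ?_) ?_) ?_) ?_) ?_
  · exact contDiffOn_rho.mul ((s A B).dirDeriv hM.isOpen _)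
  · exact contDiffOn_rho.mul (ContDiffOn.sum fun D _ => (s A D).mul (hM.contDiffOn_logDeriv D B))
  · exact contDiffOn_rho.mul (contDiffOn_const.mul (t.mul (s A B)))
  · exact contDiffOn_const.mul (s A B)
  · exact contDiffOn_const.mul ((hM.smooth A B).mul t)

theorem contDiffOn_ambientRicciRho (hM : IsMetricFamily U M) :
    ContDiffOn ℝ ∞ (ambientRicciRho M) U := by
  refine ContDiffOn.sub (contDiffOn_const.mul (hM.contDiffOn_logDerivTrace.dirDeriv hM.isOpen _)) ?_
  exact contDiffOn_const.mul (ContDiffOn.sum fun C _ => ContDiffOn.sum fun D _ =>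
    (hM.contDiffOn_logDeriv C D).mul (hM.contDiffOn_logDeriv D C))

/-- If the Taylor coefficients of `M` and `N` of orders `≤ k` agree, then those of order `k + 1`
enter `∂_ρ^k R_AB` at `ρ = 0` through an explicit linear expression. -/
theorem rhoDeriv_iterate_ambientRicci_sub (hM : IsMetricFamily U M) (hN : IsMetricFamily U N)
    {k : ℕ} (h : ∀ A B, AgreeTo U (k + 1) (fun x => M x A B) (fun x => N x A B))
    {y : Fin n → ℝ} (hy : (0, y) ∈ U) (A B : Fin n) :
    rhoDeriv^[k] (ambientRicci M A B) (0, y) - rhoDeriv^[k] (ambientRicci N A B) (0, y) =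
      (k + 1 - (n : ℝ) / 2) * (rhoDeriv^[k + 1] (fun x => M x A B) (0, y) -
          rhoDeriv^[k + 1] (fun x => N x A B) (0, y)) -
        (1 / 2) * (M (0, y) A B * ∑ C, ∑ D, (M (0, y))⁻¹ C D *
          (rhoDeriv^[k + 1] (fun x => M x D C) (0, y) -
            rhoDeriv^[k + 1] (fun x => N x D C) (0, y))) := by
  have hU := hM.isOpen
  have split : ∀ K : ℝ × (Fin n → ℝ) → Matrix (Fin n) (Fin n) ℝ, IsMetricFamily U K →
      rhoDeriv^[k] (ambientRicci K A B) (0, y) =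
        rhoDeriv^[k] (fiberRicci K A B) (0, y)
        + rhoDeriv^[k] (fun x => x.1 * rhoDeriv (rhoDeriv fun z => K z A B) x) (0, y)
        - rhoDeriv^[k] (fun x => x.1 *
            ∑ D, rhoDeriv (fun z => K z A D) x * logDeriv K D B x) (0, y)
        + rhoDeriv^[k] (fun x => x.1 *
            ((1 / 2) * (logDerivTrace K x * rhoDeriv (fun z => K z A B) x))) (0, y)
        + (1 - (n : ℝ) / 2) * rhoDeriv^[k] (rhoDeriv (fun z => K z A B)) (0, y)
        - (1 / 2) * rhoDeriv^[k] (fun x => K x A B * logDerivTrace K x) (0, y) := by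
    intro K hK
    have s := fun A B => (hK.smooth A B).dirDeriv hU (1, 0)
    have t := hK.contDiffOn_logDerivTrace
    have s1 := hK.contDiffOn_fiberRicci A B
    have s2 : ContDiffOn ℝ ∞ (fun x => x.1 * rhoDeriv (rhoDeriv fun z => K z A B) x) U :=
      contDiffOn_rho.mul ((s A B).dirDeriv hU _)
    have s3 : ContDiffOn ℝ ∞ (fun x => x.1 *
        ∑ D, rhoDeriv (fun z => K z A D) x * logDeriv K D B x) U :=
      contDiffOn_rho.mul (ContDiffOn.sum fun D _ => (s A D).mul (hK.contDiffOn_logDeriv D B))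
    have s4 : ContDiffOn ℝ ∞ (fun x => x.1 *
        ((1 / 2) * (logDerivTrace K x * rhoDeriv (fun z => K z A B) x))) U :=
      contDiffOn_rho.mul (contDiffOn_const.mul (t.mul (s A B)))
    have s5' := s A B
    have s5 : ContDiffOn ℝ ∞ (fun x => (1 - (n : ℝ) / 2) * rhoDeriv (fun z => K z A B) x) U :=
      contDiffOn_const.mul (s A B)
    have s6' : ContDiffOn ℝ ∞ (fun x => K x A B * logDerivTrace K x) U := (hK.smooth A B).mul t
    have s6 : ContDiffOn ℝ ∞ (fun x => (1 / 2) * (K x A B * logDerivTrace K x)) U :=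
      contDiffOn_const.mul s6'
    have r1 := rhoDeriv_iterate_sub hU ((((s1.add s2).sub s3).add s4).add s5) s6 k hy
    have r2 := rhoDeriv_iterate_add hU (((s1.add s2).sub s3).add s4) s5 k hy
    have r3 := rhoDeriv_iterate_add hU ((s1.add s2).sub s3) s4 k hy
    have r4 := rhoDeriv_iterate_sub hU (s1.add s2) s3 k hy
    have r5 := rhoDeriv_iterate_add hU s1 s2 k hy
    have r6 := rhoDeriv_iterate_const_mul hU s5' (1 - (n : ℝ) / 2) k hy
    have r7 := rhoDeriv_iterate_const_mul hU s6' (1 / 2) k hy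
    refine r1.trans ?_
    simp only at r2 r3 r4 r5 r6 r7 ⊢
    erw [r2, r3, r4, r5, r6, r7]
  have d : ∀ A B, AgreeTo U k (rhoDeriv fun x => M x A B) (rhoDeriv fun x => N x A B) :=
    fun A B => (h A B).rhoDeriv hU
  have l := hM.agreeTo_logDeriv hN h
  have t := hM.agreeTo_logDerivTrace hN h
  -- The fibre Ricci tensor involves no `ρ`-derivative of the metric, so it agrees through order `k`
  -- and cancels.
  have e1 := (hM.agreeTo_fiberRicci hN h A B).2.2 k k.lt_succ_self y hy
  have e2 : ∀ K : ℝ × (Fin n → ℝ) → Matrix (Fin n) (Fin n) ℝ, IsMetricFamily U K →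
      rhoDeriv^[k] (fun x => x.1 * rhoDeriv (rhoDeriv fun z => K z A B) x) (0, y) =
        k * rhoDeriv^[k + 1] (fun z => K z A B) (0, y) := fun K hK => by
    have := rhoDeriv_iterate_rho_mul hU ((hK.smooth A B).dirDeriv hU (1, 0)) k hy
    refine this.trans ?_
    simp [Function.iterate_succ_apply]
  -- The products containing two factors `μ'` agree only to orders `< k`, but their prefactor `ρ`
  -- supplies the missing order.
  have e3 := (AgreeTo.rho_mul hU (AgreeTo.sum hU (s := Finset.univ) fun D _ =>
    (d A D).mul hU (l D B))).2.2 k k.lt_succ_self y hy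
  have e4 := (AgreeTo.rho_mul hU ((t.mul hU (d A B)).const_mul hU (1 / 2))).2.2
    k k.lt_succ_self y hy
  -- The term `μ_AB tr(μ⁻¹μ')` has no factor `ρ`, so its top derivative survives: it is the trace
  -- term of the linear expression.
  have e6 := AgreeTo.rhoDeriv_iterate_mul_sub hU (h A B) t hy
  have e7 : rhoDeriv^[k] (logDerivTrace M) (0, y) - rhoDeriv^[k] (logDerivTrace N) (0, y) =
      ∑ C, ∑ D, (M (0, y))⁻¹ C D * (rhoDeriv^[k + 1] (fun x => M x D C) (0, y) -
            rhoDeriv^[k + 1] (fun x => N x D C) (0, y)) := by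
    have sp : ∀ K : ℝ × (Fin n → ℝ) → Matrix (Fin n) (Fin n) ℝ, IsMetricFamily U K →
        rhoDeriv^[k] (logDerivTrace K) (0, y) = ∑ C, ∑ D, rhoDeriv^[k]
          (fun x => (K x)⁻¹ C D * rhoDeriv (fun z => K z D C) x) (0, y) := fun K hK => by
      have sI := contDiffOn_inv hK.smooth hK.det_ne_zero
      have s := fun A B => (hK.smooth A B).dirDeriv hU (1, 0)
      refine (rhoDeriv_iterate_sum hU Finset.univ
        (fun C _ => hK.contDiffOn_logDeriv C C) k hy).trans ?_
      refine Finset.sum_congr rfl fun C _ => ?_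
      exact rhoDeriv_iterate_sum hU Finset.univ (fun D _ => (sI C D).mul (s D C)) k hy
    rw [sp M hM, sp N hN, ← Finset.sum_sub_distrib]
    refine Finset.sum_congr rfl fun C _ => ?_
    rw [← Finset.sum_sub_distrib]
    refine Finset.sum_congr rfl fun D _ => ?_
    exact AgreeTo.rhoDeriv_iterate_mul_sub hU (hM.agreeTo_inv hN h C D) (d D C) hy
  rw [split M hM, split N hN, e1, e2 M hM, e2 N hN, e3, e4, ← e7]
  simp only [← Function.iterate_succ_apply (f := rhoDeriv)]
  linear_combination (-(1 / 2) : ℝ) * e6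

end IsMetricFamily

end Components

/-! ### Block-diagonal metrics in coordinates adapted to the splitting -/

section Block

variable {n : ℕ}

theorem pd_congr {ι : Type} [Fintype ι] [DecidableEq ι] {V : Set (ι → ℝ)} (hV : IsOpen V)
    {f g : (ι → ℝ) → ℝ} (h : ∀ q ∈ V, f q = g q) (i : ι) {p : ι → ℝ} (hp : p ∈ V) :
    pd i f p = pd i g p :=
  dirDeriv_congr hV h _ hp

theorem pd_zero {ι : Type} [Fintype ι] [DecidableEq ι] (i : ι) (p : ι → ℝ) :
    pd i (fun _ => (0 : ℝ)) p = 0 := by simp [pd]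

theorem pd_coord {ι : Type} [Fintype ι] [DecidableEq ι] (i j : ι) (p : ι → ℝ) :
    pd i (fun q => q j) p = if j = i then 1 else 0 := by
  simp only [pd]
  rw [(hasFDerivAt_apply j p).fderiv]
  simp [Pi.single_apply]

/-- The Christoffel symbols of a metric `g` on `V` are `G`, `K`, `L`, `N`, according to the types
of the indices, and the other ones vanish. -/
structure HasBlockChristoffel (V : Set (Fin 2 ⊕ Fin n → ℝ))
    (g : (Fin 2 ⊕ Fin n → ℝ) → Matrix (Fin 2 ⊕ Fin n) (Fin 2 ⊕ Fin n) ℝ)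
    (G : Fin 2 → Fin 2 → Fin 2 → (Fin 2 ⊕ Fin n → ℝ) → ℝ)
    (K : Fin 2 → Fin n → Fin n → (Fin 2 ⊕ Fin n → ℝ) → ℝ)
    (L : Fin 2 → Fin n → Fin n → (Fin 2 ⊕ Fin n → ℝ) → ℝ)
    (N : Fin n → Fin n → Fin n → (Fin 2 ⊕ Fin n → ℝ) → ℝ) : Prop where
  lll : ∀ q ∈ V, ∀ c a b, christoffel g (.inl c) (.inl a) (.inl b) q = G c a b q
  llr : ∀ q ∈ V, ∀ c a B, christoffel g (.inl c) (.inl a) (.inr B) q = 0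
  lrl : ∀ q ∈ V, ∀ c A b, christoffel g (.inl c) (.inr A) (.inl b) q = 0
  lrr : ∀ q ∈ V, ∀ c A B, christoffel g (.inl c) (.inr A) (.inr B) q = K c A B q
  rll : ∀ q ∈ V, ∀ C a b, christoffel g (.inr C) (.inl a) (.inl b) q = 0
  rlr : ∀ q ∈ V, ∀ C a B, christoffel g (.inr C) (.inl a) (.inr B) q = L a C B q
  rrl : ∀ q ∈ V, ∀ C A b, christoffel g (.inr C) (.inr A) (.inl b) q = L b C A q
  rrr : ∀ q ∈ V, ∀ C A B, christoffel g (.inr C) (.inr A) (.inr B) q = N C A B q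

namespace HasBlockChristoffel

variable {V : Set (Fin 2 ⊕ Fin n → ℝ)}
  {g : (Fin 2 ⊕ Fin n → ℝ) → Matrix (Fin 2 ⊕ Fin n) (Fin 2 ⊕ Fin n) ℝ}
  {G : Fin 2 → Fin 2 → Fin 2 → (Fin 2 ⊕ Fin n → ℝ) → ℝ}
  {K L : Fin 2 → Fin n → Fin n → (Fin 2 ⊕ Fin n → ℝ) → ℝ}
  {N : Fin n → Fin n → Fin n → (Fin 2 ⊕ Fin n → ℝ) → ℝ}

/-- The ambient metric and its rescaling share one pattern of vanishing Christoffel symbols, so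
their Ricci components are contracted once for arbitrary symbols. The first bracket has the form of
a Ricci tensor of the fibre; the rest collects the `Fin 2` directions. -/
theorem ricci_inr_inr (h : HasBlockChristoffel V g G K L N) (hV : IsOpen V)
    {p : Fin 2 ⊕ Fin n → ℝ} (hp : p ∈ V) (A B : Fin n) :
    ricci g p (.inr A) (.inr B) =
      ((∑ C, (pd (.inr C) (N C A B) p - pd (.inr B) (N C A C) p)) +
        ∑ C, ∑ D, (N C C D p * N D A B p - N C B D p * N D A C p)) +
      (∑ c, pd (.inl c) (K c A B) p + ∑ d, (∑ c, G c c d p) * K d A B p +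
        ∑ d, (∑ C, L d C C p) * K d A B p -
        ∑ c, ∑ D, (K c B D p * L c D A p + L c D B p * K c A D p)) := by
  have h1 : ∀ c, pd (.inl c) (christoffel g (.inl c) (.inr A) (.inr B)) p =
      pd (.inl c) (K c A B) p := fun c => pd_congr hV (fun q hq => h.lrr q hq c A B) _ hp
  have h2 : ∀ c, pd (.inr B) (christoffel g (.inl c) (.inr A) (.inl c)) p = 0 := fun c =>
    (pd_congr hV (fun q hq => h.lrl q hq c A c) _ hp).trans (pd_zero _ _)
  have h3 : ∀ C, pd (.inr C) (christoffel g (.inr C) (.inr A) (.inr B)) p =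
      pd (.inr C) (N C A B) p := fun C => pd_congr hV (fun q hq => h.rrr q hq C A B) _ hp
  have h4 : ∀ C, pd (.inr B) (christoffel g (.inr C) (.inr A) (.inr C)) p =
      pd (.inr B) (N C A C) p := fun C => pd_congr hV (fun q hq => h.rrr q hq C A C) _ hp
  simp only [ricci, Matrix.of_apply, Fintype.sum_sum_type, h1, h2, h3, h4, h.lll p hp, h.llr p hp,
    h.lrl p hp, h.lrr p hp, h.rrl p hp, h.rrr p hp, Fin.sum_univ_two,
    Finset.sum_add_distrib, Finset.sum_sub_distrib, Finset.sum_mul, Finset.sum_const_zero,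
    zero_mul, mul_zero]
  ring

theorem ricci_inl_inl (h : HasBlockChristoffel V g G K L N) (hV : IsOpen V)
    (hL : ∀ a C B, ContDiffOn ℝ ∞ (L a C B) V)
    {p : Fin 2 ⊕ Fin n → ℝ} (hp : p ∈ V) (a b : Fin 2) :
    ricci g p (.inl a) (.inl b) =
      ((∑ c, (pd (.inl c) (G c a b) p - pd (.inl b) (G c a c) p)) +
        ∑ c, ∑ d, (G c c d p * G d a b p - G c b d p * G d a c p)) +
      (∑ d, (∑ C, L d C C p) * G d a b p - pd (.inl b) (fun q => ∑ C, L a C C q) p -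
        ∑ C, ∑ D, L b C D p * L a D C p) := by
  have h1 : ∀ c, pd (.inl c) (christoffel g (.inl c) (.inl a) (.inl b)) p =
      pd (.inl c) (G c a b) p := fun c => pd_congr hV (fun q hq => h.lll q hq c a b) _ hp
  have h2 : ∀ c, pd (.inl b) (christoffel g (.inl c) (.inl a) (.inl c)) p =
      pd (.inl b) (G c a c) p := fun c => pd_congr hV (fun q hq => h.lll q hq c a c) _ hp
  have h3 : ∀ C, pd (.inr C) (christoffel g (.inr C) (.inl a) (.inl b)) p = 0 := fun C =>
    (pd_congr hV (fun q hq => h.rll q hq C a b) _ hp).trans (pd_zero _ _)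
  have h4 : ∀ C, pd (.inl b) (christoffel g (.inr C) (.inl a) (.inr C)) p =
      pd (.inl b) (L a C C) p := fun C => pd_congr hV (fun q hq => h.rlr q hq C a C) _ hp
  have h5 : pd (.inl b) (fun q => ∑ C, L a C C q) p = ∑ C, pd (.inl b) (L a C C) p :=
    dirDeriv_sum _ _ fun C _ => (hL a C C).differentiableAt_of_isOpen hV hp
  simp only [ricci, Matrix.of_apply, Fintype.sum_sum_type, h1, h2, h3, h4, h5, h.lll p hp,
    h.llr p hp, h.rll p hp, h.rlr p hp, h.rrl p hp, Fin.sum_univ_two,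
    Finset.sum_add_distrib, Finset.sum_sub_distrib, Finset.sum_mul, Finset.sum_const_zero,
    zero_mul, mul_zero]
  ring

end HasBlockChristoffel

theorem inv_fromBlocks_diagonal {a b : Matrix (Fin 2) (Fin 2) ℝ} {m i : Matrix (Fin n) (Fin n) ℝ}
    (hb : a * b = 1) (hi : m * i = 1) :
    (Matrix.fromBlocks a 0 0 m)⁻¹ = Matrix.fromBlocks b 0 0 i :=
  Matrix.inv_eq_right_inv (by simp [Matrix.fromBlocks_multiply, hb, hi])

/-- The Christoffel symbols of a block-diagonal metric whose first block depends on the first two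
coordinates only. -/
theorem hasBlockChristoffel_fromBlocks {V : Set (Fin 2 ⊕ Fin n → ℝ)}
    {g : (Fin 2 ⊕ Fin n → ℝ) → Matrix (Fin 2 ⊕ Fin n) (Fin 2 ⊕ Fin n) ℝ}
    {a b : (Fin 2 ⊕ Fin n → ℝ) → Matrix (Fin 2) (Fin 2) ℝ}
    {m i : (Fin 2 ⊕ Fin n → ℝ) → Matrix (Fin n) (Fin n) ℝ}
    (hg : ∀ q, g q = Matrix.fromBlocks (a q) 0 0 (m q))
    (hb : ∀ q ∈ V, a q * b q = 1) (hi : ∀ q ∈ V, m q * i q = 1)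
    (ha : ∀ q ∈ V, ∀ A c d, pd (.inr A) (fun z => a z c d) q = 0) :
    HasBlockChristoffel V g
      (fun c e f q => (1 / 2) * ∑ d, b q c d * (pd (.inl e) (fun z => a z d f) q +
        pd (.inl f) (fun z => a z d e) q - pd (.inl d) (fun z => a z e f) q))
      (fun c A B q => (1 / 2) * ∑ d, b q c d * -pd (.inl d) (fun z => m z A B) q)
      (fun e C B q => (1 / 2) * ∑ D, i q C D * pd (.inl e) (fun z => m z D B) q)
      (fun C A B q => (1 / 2) * ∑ D, i q C D * (pd (.inr A) (fun z => m z D B) q +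
        pd (.inr B) (fun z => m z D A) q - pd (.inr D) (fun z => m z A B) q)) := by
  constructor <;> intro q hq <;> intros <;>
    simp [christoffel, inv_fromBlocks_diagonal (hb q hq) (hi q hq), hg, Fintype.sum_sum_type, pd_zero, ha q hq]

/-- The chain rule for functions of `(r, y)`, where `r` is a function of the coordinates. -/
theorem pd_comp_prodMk {r : (Fin 2 ⊕ Fin n → ℝ) → ℝ} {f : ℝ × (Fin n → ℝ) → ℝ}
    {p : Fin 2 ⊕ Fin n → ℝ} (hr : DifferentiableAt ℝ r p)
    (hf : DifferentiableAt ℝ f (r p, fun A => p (.inr A))) (k : Fin 2 ⊕ Fin n) :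
    pd k (fun q => f (r q, fun A => q (.inr A))) p =
      pd k r p * rhoDeriv f (r p, fun A => p (.inr A)) +
        fderiv ℝ f (r p, fun A => p (.inr A)) (0, fun A => (Pi.single k 1 : _ → ℝ) (.inr A)) := by
  have hπ : HasFDerivAt (fun q : Fin 2 ⊕ Fin n → ℝ => fun A : Fin n => q (.inr A))
      (ContinuousLinearMap.pi fun A => ContinuousLinearMap.proj (.inr A)) p :=
    (ContinuousLinearMap.pi fun A : Fin n => ContinuousLinearMap.proj (R := ℝ)
      (φ := fun _ : Fin 2 ⊕ Fin n => ℝ) (.inr A)).hasFDerivAt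
  have h := hf.hasFDerivAt.comp p (hr.hasFDerivAt.prodMk hπ)
  have e : pd k (fun q => f (r q, fun A => q (.inr A))) p =
      fderiv ℝ f (r p, fun A => p (.inr A))
        (pd k r p, fun A => (Pi.single k 1 : _ → ℝ) (.inr A)) := by
    simp only [pd]
    rw [show (fun q => f (r q, fun A => q (.inr A))) = f ∘ fun q => (r q, fun A => q (.inr A))
      from rfl, h.fderiv]
    rfl
  rw [e, show ((pd k r p, fun A => (Pi.single k 1 : _ → ℝ) (.inr A)) : ℝ × (Fin n → ℝ)) =
    pd k r p • (1, 0) + (0, fun A => (Pi.single k 1 : _ → ℝ) (.inr A)) by simp, map_add, map_smul]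
  rfl

theorem pd_inl_comp_prodMk {r : (Fin 2 ⊕ Fin n → ℝ) → ℝ} {f : ℝ × (Fin n → ℝ) → ℝ}
    {p : Fin 2 ⊕ Fin n → ℝ} (hr : DifferentiableAt ℝ r p)
    (hf : DifferentiableAt ℝ f (r p, fun A => p (.inr A))) (k : Fin 2) :
    pd (.inl k) (fun q => f (r q, fun A => q (.inr A))) p =
      pd (.inl k) r p * rhoDeriv f (r p, fun A => p (.inr A)) := by
  rw [pd_comp_prodMk hr hf, show ((0, fun A => (Pi.single (Sum.inl k) 1 : Fin 2 ⊕ Fin n → ℝ)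
    (.inr A)) : ℝ × (Fin n → ℝ)) = 0 by ext <;> simp, map_zero, add_zero]

theorem pd_inr_comp_prodMk {r : (Fin 2 ⊕ Fin n → ℝ) → ℝ} {f : ℝ × (Fin n → ℝ) → ℝ}
    {p : Fin 2 ⊕ Fin n → ℝ} (hr : DifferentiableAt ℝ r p)
    (hf : DifferentiableAt ℝ f (r p, fun A => p (.inr A))) (B : Fin n)
    (hB : pd (.inr B) r p = 0) :
    pd (.inr B) (fun q => f (r q, fun A => q (.inr A))) p =
      yDeriv B f (r p, fun A => p (.inr A)) := by
  rw [pd_comp_prodMk hr hf, hB, zero_mul, zero_add]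
  simp only [dirDeriv]
  congr 2
  ext A; simp [Pi.single_apply]

end Block

theorem pd_mul {ι : Type} [Fintype ι] [DecidableEq ι] (i : ι) {f g : (ι → ℝ) → ℝ} {p : ι → ℝ}
    (hf : DifferentiableAt ℝ f p) (hg : DifferentiableAt ℝ g p) :
    pd i (fun q => f q * g q) p = pd i f p * g p + f p * pd i g p :=
  dirDeriv_mul _ hf hg

theorem pd_add {ι : Type} [Fintype ι] [DecidableEq ι] (i : ι) {f g : (ι → ℝ) → ℝ} {p : ι → ℝ}
    (hf : DifferentiableAt ℝ f p) (hg : DifferentiableAt ℝ g p) :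
    pd i (fun q => f q + g q) p = pd i f p + pd i g p :=
  dirDeriv_add _ hf hg

theorem pd_const_mul {ι : Type} [Fintype ι] [DecidableEq ι] (i : ι) (c : ℝ) {f : (ι → ℝ) → ℝ}
    {p : ι → ℝ} (hf : DifferentiableAt ℝ f p) : pd i (fun q => c * f q) p = c * pd i f p :=
  dirDeriv_const_mul _ c hf

theorem pd_const {ι : Type} [Fintype ι] [DecidableEq ι] (i : ι) (c : ℝ) (p : ι → ℝ) :
    pd i (fun _ => c) p = 0 := by simp [pd]

namespace HasBlockChristoffel

variable {n : ℕ} {V : Set (Fin 2 ⊕ Fin n → ℝ)}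
  {g : (Fin 2 ⊕ Fin n → ℝ) → Matrix (Fin 2 ⊕ Fin n) (Fin 2 ⊕ Fin n) ℝ}
  {G G' : Fin 2 → Fin 2 → Fin 2 → (Fin 2 ⊕ Fin n → ℝ) → ℝ}
  {K L K' L' : Fin 2 → Fin n → Fin n → (Fin 2 ⊕ Fin n → ℝ) → ℝ}
  {N N' : Fin n → Fin n → Fin n → (Fin 2 ⊕ Fin n → ℝ) → ℝ}

theorem congr (h : HasBlockChristoffel V g G K L N) (hG : ∀ q ∈ V, ∀ c a b, G c a b q = G' c a b q)
    (hK : ∀ q ∈ V, ∀ c A B, K c A B q = K' c A B q) (hL : ∀ q ∈ V, ∀ a C B, L a C B q = L' a C B q)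
    (hN : ∀ q ∈ V, ∀ C A B, N C A B q = N' C A B q) : HasBlockChristoffel V g G' K' L' N' where
  lll q hq c a b := (h.lll q hq c a b).trans (hG q hq c a b)
  llr := h.llr
  lrl := h.lrl
  lrr q hq c A B := (h.lrr q hq c A B).trans (hK q hq c A B)
  rll := h.rll
  rlr q hq C a B := (h.rlr q hq C a B).trans (hL q hq a C B)
  rrl q hq C A b := (h.rrl q hq C A b).trans (hL q hq b C A)
  rrr q hq C A B := (h.rrr q hq C A B).trans (hN q hq C A B)

end HasBlockChristoffel

/-! ### Trace and symmetry identities for `M⁻¹ ∂_ρ M` -/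

namespace IsMetricFamily

variable {n : ℕ} {U : Set (ℝ × (Fin n → ℝ))} {M : ℝ × (Fin n → ℝ) → Matrix (Fin n) (Fin n) ℝ}

theorem rhoDeriv_symm (hM : IsMetricFamily U M) {x} (hx : x ∈ U) (A B : Fin n) :
    rhoDeriv (fun z => M z A B) x = rhoDeriv (fun z => M z B A) x :=
  dirDeriv_congr hM.isOpen (fun z hz => hM.symm z hz A B) _ hx

theorem sum_mul_logDeriv (hM : IsMetricFamily U M) {x} (hx : x ∈ U) (A B : Fin n) :
    ∑ D, M x A D * logDeriv M D B x = rhoDeriv (fun z => M z A B) x := by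
  simp only [logDeriv, Finset.mul_sum]
  rw [Finset.sum_comm]
  simp only [← mul_assoc, ← Finset.sum_mul]
  have : ∀ D, ∑ E, M x A E * (M x)⁻¹ E D = (1 : Matrix (Fin n) (Fin n) ℝ) A D := fun D => by
    rw [← hM.mul_inv hx, Matrix.mul_apply]
  simp [this, Matrix.one_apply]

/-- Both sides are entries of `μ' μ⁻¹ μ'`, a symmetric matrix because `μ` and hence `μ'` and `μ⁻¹`
are. -/
theorem sum_rhoDeriv_mul_logDeriv_symm (hM : IsMetricFamily U M) {x} (hx : x ∈ U) (A B : Fin n) :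
    ∑ D, rhoDeriv (fun z => M z A D) x * logDeriv M D B x =
      ∑ D, rhoDeriv (fun z => M z B D) x * logDeriv M D A x := by
  simp only [logDeriv, Finset.mul_sum]
  rw [Finset.sum_comm]
  refine Finset.sum_congr rfl fun D _ => Finset.sum_congr rfl fun E _ => ?_
  rw [hM.inv_symm hx E D, hM.rhoDeriv_symm hx D B, hM.rhoDeriv_symm hx A E]
  ring

theorem sum_inv_mul_rhoDeriv (hM : IsMetricFamily U M) {x} (hx : x ∈ U) :
    ∑ A, ∑ B, (M x)⁻¹ A B * rhoDeriv (fun z => M z A B) x = logDerivTrace M x := by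
  simp only [logDerivTrace, logDeriv]
  refine Finset.sum_congr rfl fun A _ => Finset.sum_congr rfl fun B _ => ?_
  rw [hM.rhoDeriv_symm hx A B]

theorem sum_inv_mul (hM : IsMetricFamily U M) {x} (hx : x ∈ U) :
    ∑ A, ∑ B, (M x)⁻¹ A B * M x A B = n := by
  have : ∀ A, ∑ B, (M x)⁻¹ A B * M x A B = ((M x)⁻¹ * M x) A A := fun A => by
    rw [Matrix.mul_apply]
    exact Finset.sum_congr rfl fun B _ => by rw [hM.symm x hx A B]
  simp [this, hM.inv_mul hx]

end IsMetricFamily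

/-! ### The Ricci tensor of the conformally rescaled metric -/

section Conformal

variable {n : ℕ} {U : Set (ℝ × (Fin n → ℝ))} {M : ℝ × (Fin n → ℝ) → Matrix (Fin n) (Fin n) ℝ}

/-- The map `(u, v, y) ↦ (uv, y)`. -/
def conformalProj (q : Fin 2 ⊕ Fin n → ℝ) : ℝ × (Fin n → ℝ) :=
  (q (.inl 0) * q (.inl 1), fun A => q (.inr A))

theorem contDiff_conformalProj : ContDiff ℝ ∞ (conformalProj (n := n)) := by
  unfold conformalProj; fun_prop

theorem isOpen_preimage_conformalProj (hU : IsOpen U) : IsOpen (conformalProj ⁻¹' U) :=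
  hU.preimage contDiff_conformalProj.continuous

theorem contDiffOn_comp_conformalProj {f : ℝ × (Fin n → ℝ) → ℝ} (hf : ContDiffOn ℝ ∞ f U) :
    ContDiffOn ℝ ∞ (fun q => f (conformalProj q)) (conformalProj ⁻¹' U) :=
  hf.comp contDiff_conformalProj.contDiffOn fun _ h => h

/-- In `Fin 2` the index `1 - e` is the other null coordinate, so `∂_u` and `∂_v` are treated at
once here and below. -/
theorem pd_inl_mul (e : Fin 2) (p : Fin 2 ⊕ Fin n → ℝ) :
    pd (.inl e) (fun q => q (.inl 0) * q (.inl 1)) p = p (.inl (1 - e)) := by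
  rw [pd_mul _ (by fun_prop) (by fun_prop), pd_coord, pd_coord]
  fin_cases e <;> simp

theorem pd_inr_mul (B : Fin n) (p : Fin 2 ⊕ Fin n → ℝ) :
    pd (.inr B) (fun q => q (.inl 0) * q (.inl 1)) p = 0 := by
  rw [pd_mul _ (by fun_prop) (by fun_prop), pd_coord, pd_coord]
  simp

theorem pd_inl_comp_conformalProj (hU : IsOpen U) {f : ℝ × (Fin n → ℝ) → ℝ}
    (hf : ContDiffOn ℝ ∞ f U) {p : Fin 2 ⊕ Fin n → ℝ} (hp : conformalProj p ∈ U) (e : Fin 2) :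
    pd (.inl e) (fun q => f (conformalProj q)) p =
      p (.inl (1 - e)) * rhoDeriv f (conformalProj p) := by
  rw [← pd_inl_mul e p]
  exact pd_inl_comp_prodMk (by fun_prop) (hf.differentiableAt_of_isOpen hU hp) e

theorem pd_inr_comp_conformalProj (hU : IsOpen U) {f : ℝ × (Fin n → ℝ) → ℝ}
    (hf : ContDiffOn ℝ ∞ f U) {p : Fin 2 ⊕ Fin n → ℝ} (hp : conformalProj p ∈ U) (B : Fin n) :
    pd (.inr B) (fun q => f (conformalProj q)) p = yDeriv B f (conformalProj p) :=
  pd_inr_comp_prodMk (by fun_prop) (hf.differentiableAt_of_isOpen hU hp) B (pd_inr_mul B p)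

/-- Each null coordinate times its own derivative of `uv` is again `uv`; hence the result depends on
`u` and `v` only through `ρ = uv`. -/
theorem pd_half_coord_mul_comp_conformalProj (hU : IsOpen U) {f : ℝ × (Fin n → ℝ) → ℝ}
    (hf : ContDiffOn ℝ ∞ f U) {p : Fin 2 ⊕ Fin n → ℝ} (hp : conformalProj p ∈ U) (e : Fin 2) :
    pd (.inl e) (fun q => 1 / 2 * (q (.inl e) * f (conformalProj q))) p =
      1 / 2 * (f (conformalProj p) + (conformalProj p).1 * rhoDeriv f (conformalProj p)) := by
  have hd := (contDiffOn_comp_conformalProj hf).differentiableAt_of_isOpen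
    (isOpen_preimage_conformalProj hU) hp
  have hc : DifferentiableAt ℝ (fun q : Fin 2 ⊕ Fin n → ℝ => q (.inl e)) p := by fun_prop
  have hm : DifferentiableAt ℝ
      (fun q : Fin 2 ⊕ Fin n → ℝ => q (.inl e) * f (conformalProj q)) p := hc.mul hd
  rw [pd_const_mul _ _ hm, pd_mul _ hc hd, pd_coord,
    pd_inl_comp_conformalProj hU hf hp]
  have : p (.inl e) * p (.inl (1 - e)) = (conformalProj p).1 := by
    fin_cases e <;> simp [conformalProj, mul_comm]
  rw [← this]; simp; ring

theorem conformalMetric_eq (q : Fin 2 ⊕ Fin n → ℝ) :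
    conformalMetric (fun r z => M (r, z)) q =
      Matrix.fromBlocks !![0, -1; -1, 0] 0 0 (M (conformalProj q)) := rfl

theorem inv_conformalMetric (hM : IsMetricFamily U M) {q : Fin 2 ⊕ Fin n → ℝ}
    (hq : conformalProj q ∈ U) : (conformalMetric (fun r z => M (r, z)) q)⁻¹ =
      Matrix.fromBlocks !![0, -1; -1, 0] 0 0 (M (conformalProj q))⁻¹ := by
  rw [conformalMetric_eq]
  exact inv_fromBlocks_diagonal (by ext i j; fin_cases i <;> fin_cases j <;> simp)
    (hM.mul_inv hq)

theorem hasBlockChristoffel_conformalMetric (hM : IsMetricFamily U M) :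
    HasBlockChristoffel (conformalProj ⁻¹' U) (conformalMetric fun r z => M (r, z))
      (fun _ _ _ _ => 0)
      (fun c A B q => 1 / 2 * (q (.inl c) * rhoDeriv (fun z => M z A B) (conformalProj q)))
      (fun e C B q => 1 / 2 * (q (.inl (1 - e)) * logDeriv M C B (conformalProj q)))
      (fun C A B q => fiberChristoffel M C A B (conformalProj q)) := by
  have hU := hM.isOpen
  refine (hasBlockChristoffel_fromBlocks (a := fun _ => !![0, -1; -1, 0])
    (b := fun _ => !![0, -1; -1, 0]) (m := fun q => M (conformalProj q))
    (i := fun q => (M (conformalProj q))⁻¹) conformalMetric_eq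
    (fun q _ => by ext i j; fin_cases i <;> fin_cases j <;> simp)
    (fun q hq => hM.mul_inv hq) (fun q _ A c d => pd_const _ _ _)).congr ?_ ?_ ?_ ?_
  · intro q _ c a b; simp [pd_const]
  · intro q hq c A B
    simp only [pd_inl_comp_conformalProj hU (hM.smooth A B) hq]
    fin_cases c <;> simp
  · intro q hq e C B
    simp only [fun D => pd_inl_comp_conformalProj hU (hM.smooth D B) hq, logDeriv, Finset.mul_sum]
    exact Finset.sum_congr rfl fun D _ => by ring
  · intro q hq C A B
    simp only [fun D E F => pd_inr_comp_conformalProj hU (hM.smooth D E) hq F, fiberChristoffel]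

/-- The last two summands are the conformal correction to `R_AB`. They are the ones that cancel
against the Hessian of `v` and the scalar curvature in `𝒬`. -/
theorem ricci_conformalMetric_inr (hM : IsMetricFamily U M) {p : Fin 2 ⊕ Fin n → ℝ}
    (hp : conformalProj p ∈ U) (A B : Fin n) :
    ricci (conformalMetric fun r z => M (r, z)) p (.inr A) (.inr B) =
      ambientRicci M A B (conformalProj p) +
        n / 2 * rhoDeriv (fun z => M z A B) (conformalProj p) +
        1 / 2 * (M (conformalProj p) A B * logDerivTrace M (conformalProj p)) := by
  have hU := hM.isOpen
  rw [(hasBlockChristoffel_conformalMetric hM).ricci_inr_inr (isOpen_preimage_conformalProj hU) hp]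
  have h1 : ∀ c, pd (.inl c) (fun q => 1 / 2 * (q (.inl c) *
      rhoDeriv (fun z => M z A B) (conformalProj q))) p = _ := fun c =>
    pd_half_coord_mul_comp_conformalProj hU ((hM.smooth A B).dirDeriv hU (1, 0)) hp c
  have h2 : ∀ C D E F, pd (.inr F) (fun q => fiberChristoffel M C D E (conformalProj q)) p = _ :=
    fun C D E F => pd_inr_comp_conformalProj hU (hM.contDiffOn_fiberChristoffel C D E) hp F
  have h3 : ∀ c, ∑ D, (1 / 2 * (p (.inl c) * rhoDeriv (fun z => M z B D) (conformalProj p)) *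
        (1 / 2 * (p (.inl (1 - c)) * logDeriv M D A (conformalProj p))) +
      1 / 2 * (p (.inl (1 - c)) * logDeriv M D B (conformalProj p)) *
        (1 / 2 * (p (.inl c) * rhoDeriv (fun z => M z A D) (conformalProj p)))) =
      1 / 2 * ((conformalProj p).1 * ∑ D, rhoDeriv (fun z => M z A D) (conformalProj p) *
        logDeriv M D B (conformalProj p)) := fun c => by
    have e : (conformalProj p).1 = p (.inl c) * p (.inl (1 - c)) := by
      fin_cases c <;> simp [conformalProj, mul_comm]
    have s := hM.sum_rhoDeriv_mul_logDeriv_symm hp B A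
    calc _ = p (.inl c) * p (.inl (1 - c)) / 4 *
          ((∑ D, rhoDeriv (fun z => M z B D) (conformalProj p) * logDeriv M D A (conformalProj p)) +
          ∑ D, rhoDeriv (fun z => M z A D) (conformalProj p) * logDeriv M D B (conformalProj p)) := by
          rw [← Finset.sum_add_distrib, Finset.mul_sum]
          exact Finset.sum_congr rfl fun D _ => by ring
      _ = _ := by rw [s, e]; ring
  have h4 : ∀ c, (∑ C, 1 / 2 * (p (.inl (1 - c)) * logDeriv M C C (conformalProj p))) =
      1 / 2 * (p (.inl (1 - c)) * logDerivTrace M (conformalProj p)) := fun c => by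
    simp only [logDerivTrace, Finset.mul_sum]
  simp only [h1, h2, h3, h4, Fin.sum_univ_two]
  have e : (conformalProj p).1 = p (.inl 0) * p (.inl 1) := rfl
  simp only [ambientRicci, fiberRicci, e]
  simp
  ring

/-- The inverse of the `(u, v)` block is off-diagonal, so the mixed components suffice for every
trace. -/
theorem ricci_conformalMetric_inl (hM : IsMetricFamily U M) {p : Fin 2 ⊕ Fin n → ℝ}
    (hp : conformalProj p ∈ U) (a : Fin 2) :
    ricci (conformalMetric fun r z => M (r, z)) p (.inl a) (.inl (1 - a)) =
      (conformalProj p).1 * ambientRicciRho M (conformalProj p) -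
        1 / 2 * logDerivTrace M (conformalProj p) := by
  have hU := hM.isOpen
  have hL : ∀ a C B, ContDiffOn ℝ ∞ (fun q : Fin 2 ⊕ Fin n → ℝ => 1 / 2 * (q (.inl (1 - a)) *
      logDeriv M C B (conformalProj q))) (conformalProj ⁻¹' U) := fun a C B =>
    contDiffOn_const.mul ((contDiff_apply ℝ ℝ (Sum.inl (1 - a))).contDiffOn.mul
      (contDiffOn_comp_conformalProj (hM.contDiffOn_logDeriv C B)))
  rw [(hasBlockChristoffel_conformalMetric hM).ricci_inl_inl (isOpen_preimage_conformalProj hU)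
    hL hp]
  have h1 : (fun q : Fin 2 ⊕ Fin n → ℝ =>
      ∑ C, 1 / 2 * (q (.inl (1 - a)) * logDeriv M C C (conformalProj q))) =
      fun q => 1 / 2 * (q (.inl (1 - a)) * logDerivTrace M (conformalProj q)) := by
    funext q; simp only [logDerivTrace, Finset.mul_sum]
  have h2 : ∑ C, ∑ D, 1 / 2 * (p (.inl (1 - (1 - a))) * logDeriv M C D (conformalProj p)) *
      (1 / 2 * (p (.inl (1 - a)) * logDeriv M D C (conformalProj p))) =
      1 / 4 * ((conformalProj p).1 *
        ∑ C, ∑ D, logDeriv M C D (conformalProj p) * logDeriv M D C (conformalProj p)) := by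
    have e : (conformalProj p).1 = p (.inl (1 - (1 - a))) * p (.inl (1 - a)) := by
      fin_cases a <;> simp [conformalProj, mul_comm]
    rw [e]
    simp only [Finset.mul_sum]
    exact Finset.sum_congr rfl fun C _ => Finset.sum_congr rfl fun D _ => by ring
  rw [h1, pd_half_coord_mul_comp_conformalProj hU hM.contDiffOn_logDerivTrace hp (1 - a), h2]
  simp only [pd_zero, ambientRicciRho]
  simp
  ring

/-- `t² Scal` for the straight ambient metric of `M`. -/
def ambientScal (M : ℝ × (Fin n → ℝ) → Matrix (Fin n) (Fin n) ℝ) (x : ℝ × (Fin n → ℝ)) : ℝ :=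
  (∑ A, ∑ B, (M x)⁻¹ A B * ambientRicci M A B x) - 2 * (x.1 * ambientRicciRho M x)

theorem sum_inv_conformalMetric_mul (hM : IsMetricFamily U M) {p : Fin 2 ⊕ Fin n → ℝ}
    (hp : conformalProj p ∈ U) (T : Matrix (Fin 2 ⊕ Fin n) (Fin 2 ⊕ Fin n) ℝ) :
    ∑ i, ∑ j, (conformalMetric (fun r z => M (r, z)) p)⁻¹ i j * T i j =
      -T (.inl 0) (.inl 1) - T (.inl 1) (.inl 0) +
        ∑ A, ∑ B, (M (conformalProj p))⁻¹ A B * T (.inr A) (.inr B) := by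
  simp [inv_conformalMetric hM hp, Fintype.sum_sum_type]
  ring

theorem scal_conformalMetric (hM : IsMetricFamily U M) {p : Fin 2 ⊕ Fin n → ℝ}
    (hp : conformalProj p ∈ U) :
    scal (conformalMetric fun r z => M (r, z)) p =
      ambientScal M (conformalProj p) + (n + 1) * logDerivTrace M (conformalProj p) := by
  rw [scal, sum_inv_conformalMetric_mul hM hp]
  have h0 := ricci_conformalMetric_inl hM hp 0
  have h1 := ricci_conformalMetric_inl hM hp 1
  simp only [sub_zero, sub_self] at h0 h1
  simp only [h0, h1, ricci_conformalMetric_inr hM hp, mul_add, Finset.sum_add_distrib]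
  have e1 := hM.sum_inv_mul_rhoDeriv hp
  have e2 := hM.sum_inv_mul hp
  have e3 : ∑ A, ∑ B, (M (conformalProj p))⁻¹ A B *
      (n / 2 * rhoDeriv (fun z => M z A B) (conformalProj p)) =
      n / 2 * logDerivTrace M (conformalProj p) := by
    rw [← e1]; simp only [Finset.mul_sum]
    exact Finset.sum_congr rfl fun C _ => Finset.sum_congr rfl fun D _ => by ring
  have e4 : ∑ A, ∑ B, (M (conformalProj p))⁻¹ A B * (1 / 2 *
      (M (conformalProj p) A B * logDerivTrace M (conformalProj p))) =
      n * (1 / 2 * logDerivTrace M (conformalProj p)) := by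
    rw [← e2]; simp only [Finset.sum_mul]
    exact Finset.sum_congr rfl fun C _ => Finset.sum_congr rfl fun D _ => by ring
  rw [e3, e4, ambientScal]
  ring

/-! ### The tensor `𝒬` and its trace-adjusted form in terms of the ambient Ricci tensor -/

theorem pd_conformalFactor (k : Fin 2 ⊕ Fin n) :
    pd k (conformalFactor (n := n)) = fun _ => if Sum.inl 1 = k then 1 else 0 :=
  funext fun p => pd_coord k (.inl 1) p

theorem hess_conformalMetric_inr (hM : IsMetricFamily U M) {p : Fin 2 ⊕ Fin n → ℝ}
    (hp : conformalProj p ∈ U) (A B : Fin n) :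
    hess (conformalMetric fun r z => M (r, z)) conformalFactor p (.inr A) (.inr B) =
      -(1 / 2 * (p (.inl 1) * rhoDeriv (fun z => M z A B) (conformalProj p))) := by
  simp [hess, pd_conformalFactor, pd_const,
    (hasBlockChristoffel_conformalMetric hM).lrr p hp]

theorem hess_conformalMetric_inl (hM : IsMetricFamily U M) {p : Fin 2 ⊕ Fin n → ℝ}
    (hp : conformalProj p ∈ U) (a b : Fin 2) :
    hess (conformalMetric fun r z => M (r, z)) conformalFactor p (.inl a) (.inl b) = 0 := by
  simp [hess, pd_conformalFactor, pd_const,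
    (hasBlockChristoffel_conformalMetric hM).lll p hp]

/-- This is `𝒬 = v Sch_g`. The Hessian `-½ v μ'` cancels the correction `(n/2) μ'` of the Ricci
tensor after division by `n`; the correction `½ tr(μ⁻¹μ') μ` cancels the summand `(n+1) tr(μ⁻¹μ')`
of `Scal`. The right side thus has `v` as an explicit factor. -/
theorem Q_conformalMetric_inr (hn : n ≠ 0) (hM : IsMetricFamily U M) {p : Fin 2 ⊕ Fin n → ℝ}
    (hp : conformalProj p ∈ U) (A B : Fin n) :
    Q (conformalMetric fun r z => M (r, z)) conformalFactor p (.inr A) (.inr B) =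
      p (.inl 1) * (1 / n * (ambientRicci M A B (conformalProj p) -
        1 / (2 * (n + 1)) * (ambientScal M (conformalProj p) * M (conformalProj p) A B))) := by
  have h0 : (n : ℝ) ≠ 0 := by exact_mod_cast hn
  have h1 : (n : ℝ) + 1 ≠ 0 := by positivity
  simp only [Q, schouten, Matrix.add_apply, Matrix.smul_apply, Matrix.sub_apply, smul_eq_mul,
    hess_conformalMetric_inr hM hp, ricci_conformalMetric_inr hM hp, scal_conformalMetric hM hp,
    conformalMetric_eq, Matrix.fromBlocks_apply₂₂, conformalFactor, Fintype.card_sum,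
    Fintype.card_fin]
  push_cast
  rw [show (2 : ℝ) + n - 2 = n by ring, show (2 : ℝ) + n - 1 = n + 1 by ring]
  field_simp
  ring

theorem Q_conformalMetric_inl (hn : n ≠ 0) (hM : IsMetricFamily U M) {p : Fin 2 ⊕ Fin n → ℝ}
    (hp : conformalProj p ∈ U) (a : Fin 2) :
    Q (conformalMetric fun r z => M (r, z)) conformalFactor p (.inl a) (.inl (1 - a)) =
      p (.inl 1) * (1 / n * ((conformalProj p).1 * ambientRicciRho M (conformalProj p) +
        1 / (2 * (n + 1)) * ambientScal M (conformalProj p))) := by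
  have h0 : (n : ℝ) ≠ 0 := by exact_mod_cast hn
  have h1 : (n : ℝ) + 1 ≠ 0 := by positivity
  have e : (!![0, -1; -1, 0] : Matrix (Fin 2) (Fin 2) ℝ) a (1 - a) = -1 := by
    fin_cases a <;> simp
  simp only [Q, schouten, Matrix.add_apply, Matrix.smul_apply, Matrix.sub_apply, smul_eq_mul,
    hess_conformalMetric_inl hM hp, ricci_conformalMetric_inl hM hp, scal_conformalMetric hM hp,
    conformalMetric_eq, Matrix.fromBlocks_apply₁₁, conformalFactor, Fintype.card_sum,
    Fintype.card_fin, e]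
  push_cast
  rw [show (2 : ℝ) + n - 2 = n by ring, show (2 : ℝ) + n - 1 = n + 1 by ring]
  field_simp
  ring

/-- The trace-free part of `v Sch_g` in dimension `n + 2` is `v/n` times that of the Ricci tensor,
whence the constant `1/(n+2)`. Compared with `𝒬_AB`, only a multiple of `μ_AB` has changed. -/
theorem quasiEinstein_conformalMetric_inr (hn : n ≠ 0) (hM : IsMetricFamily U M)
    {p : Fin 2 ⊕ Fin n → ℝ} (hp : conformalProj p ∈ U) (A B : Fin n) :
    quasiEinstein (conformalMetric fun r z => M (r, z)) conformalFactor p (.inr A) (.inr B) =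
      p (.inl 1) * (1 / n * (ambientRicci M A B (conformalProj p) -
        1 / (n + 2) * (ambientScal M (conformalProj p) * M (conformalProj p) A B))) := by
  have h0 : (n : ℝ) ≠ 0 := by exact_mod_cast hn
  have h1 : (n : ℝ) + 1 ≠ 0 := by positivity
  have h2 : (n : ℝ) + 2 ≠ 0 := by positivity
  have q0 := Q_conformalMetric_inl hn hM hp 0
  have q1 := Q_conformalMetric_inl hn hM hp 1
  simp only [sub_zero, sub_self] at q0 q1
  have e2 := hM.sum_inv_mul hp
  have e3 : ∑ A, ∑ B, (M (conformalProj p))⁻¹ A B *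
      (p (.inl 1) * (1 / n * (ambientRicci M A B (conformalProj p) -
        1 / (2 * (n + 1)) * (ambientScal M (conformalProj p) * M (conformalProj p) A B)))) =
      p (.inl 1) * (1 / n) * (∑ A, ∑ B, (M (conformalProj p))⁻¹ A B *
        ambientRicci M A B (conformalProj p)) -
      p (.inl 1) * (1 / n) * (1 / (2 * (n + 1)) * ambientScal M (conformalProj p) * n) := by
    -- Writing `n` as the trace of `μ` makes the last term a double sum. This also rewrites the `n`
    -- in the denominators, which is undone under the sums.
    conv_rhs => rw [← e2]
    simp only [Finset.mul_sum, ← Finset.sum_sub_distrib]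
    refine Finset.sum_congr rfl fun C _ => Finset.sum_congr rfl fun D _ => ?_
    rw [e2]; ring
  have e4 : ∑ A, ∑ B, (M (conformalProj p))⁻¹ A B * ambientRicci M A B (conformalProj p) =
      ambientScal M (conformalProj p) +
        2 * ((conformalProj p).1 * ambientRicciRho M (conformalProj p)) := by
    rw [ambientScal]; ring
  rw [quasiEinstein, Matrix.sub_apply, Matrix.smul_apply, smul_eq_mul,
    sum_inv_conformalMetric_mul hM hp, q0, q1]
  simp only [Q_conformalMetric_inr hn hM hp, e3, e4,
    conformalMetric_eq, Matrix.fromBlocks_apply₂₂, Fintype.card_sum, Fintype.card_fin]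
  push_cast
  rw [show (2 : ℝ) + n = n + 2 by ring]
  field_simp
  ring

end Conformal

/-! ### The Ricci tensor of the straight ambient metric -/

section AmbientRicci

variable {n : ℕ} {U : Set (ℝ × (Fin n → ℝ))} {M : ℝ × (Fin n → ℝ) → Matrix (Fin n) (Fin n) ℝ}

/-- The map `(t, ρ, y) ↦ (ρ, y)`. -/
def ambientProj (q : Fin 2 ⊕ Fin n → ℝ) : ℝ × (Fin n → ℝ) := (q (.inl 1), fun A => q (.inr A))

/-- The points with `t ≠ 0` and `(ρ, y) ∈ U`. -/
def ambientDomain (U : Set (ℝ × (Fin n → ℝ))) : Set (Fin 2 ⊕ Fin n → ℝ) :=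
  {q | q (.inl 0) ≠ 0 ∧ ambientProj q ∈ U}

theorem contDiff_ambientProj : ContDiff ℝ ∞ (ambientProj (n := n)) := by
  unfold ambientProj; fun_prop

theorem isOpen_ambientDomain (hU : IsOpen U) : IsOpen (ambientDomain U) :=
  (isOpen_ne.preimage (continuous_apply (Sum.inl 0))).inter
    (hU.preimage contDiff_ambientProj.continuous)

theorem contDiffOn_comp_ambientProj {f : ℝ × (Fin n → ℝ) → ℝ} (hf : ContDiffOn ℝ ∞ f U) :
    ContDiffOn ℝ ∞ (fun q => f (ambientProj q)) (ambientDomain U) :=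
  hf.comp contDiff_ambientProj.contDiffOn fun _ h => h.2

theorem pd_inl_comp_ambientProj (hU : IsOpen U) {f : ℝ × (Fin n → ℝ) → ℝ}
    (hf : ContDiffOn ℝ ∞ f U) {p : Fin 2 ⊕ Fin n → ℝ} (hp : p ∈ ambientDomain U) (e : Fin 2) :
    pd (.inl e) (fun q => f (ambientProj q)) p =
      (if e = 1 then 1 else 0) * rhoDeriv f (ambientProj p) := by
  refine (pd_inl_comp_prodMk (by fun_prop) (hf.differentiableAt_of_isOpen hU hp.2) e).trans ?_
  rw [pd_coord]
  simp [ambientProj, eq_comm]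

theorem pd_inr_comp_ambientProj (hU : IsOpen U) {f : ℝ × (Fin n → ℝ) → ℝ}
    (hf : ContDiffOn ℝ ∞ f U) {p : Fin 2 ⊕ Fin n → ℝ} (hp : p ∈ ambientDomain U) (B : Fin n) :
    pd (.inr B) (fun q => f (ambientProj q)) p = yDeriv B f (ambientProj p) :=
  pd_inr_comp_prodMk (by fun_prop) (hf.differentiableAt_of_isOpen hU hp.2) B
    (by rw [pd_coord]; simp)

theorem pd_inl_sq_mul_comp_ambientProj (hU : IsOpen U) {f : ℝ × (Fin n → ℝ) → ℝ}
    (hf : ContDiffOn ℝ ∞ f U) {p : Fin 2 ⊕ Fin n → ℝ} (hp : p ∈ ambientDomain U) (e : Fin 2) :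
    pd (.inl e) (fun q => q (.inl 0) ^ 2 * f (ambientProj q)) p =
      if e = 0 then 2 * p (.inl 0) * f (ambientProj p)
      else p (.inl 0) ^ 2 * rhoDeriv f (ambientProj p) := by
  have hd := (contDiffOn_comp_ambientProj hf).differentiableAt_of_isOpen
    (isOpen_ambientDomain hU) hp
  have hc : DifferentiableAt ℝ (fun q : Fin 2 ⊕ Fin n → ℝ => q (.inl 0)) p := by fun_prop
  simp only [pow_two]
  rw [pd_mul _ (hc.fun_mul hc) hd, pd_mul _ hc hc, pd_coord, pd_inl_comp_ambientProj hU hf hp]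
  fin_cases e <;> simp
  exact Or.inl (by ring)

theorem pd_inr_sq_mul_comp_ambientProj (hU : IsOpen U) {f : ℝ × (Fin n → ℝ) → ℝ}
    (hf : ContDiffOn ℝ ∞ f U) {p : Fin 2 ⊕ Fin n → ℝ} (hp : p ∈ ambientDomain U) (B : Fin n) :
    pd (.inr B) (fun q => q (.inl 0) ^ 2 * f (ambientProj q)) p =
      p (.inl 0) ^ 2 * yDeriv B f (ambientProj p) := by
  have hd := (contDiffOn_comp_ambientProj hf).differentiableAt_of_isOpen
    (isOpen_ambientDomain hU) hp
  have hc : DifferentiableAt ℝ (fun q : Fin 2 ⊕ Fin n → ℝ => q (.inl 0)) p := by fun_prop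
  simp only [pow_two]
  rw [pd_mul _ (hc.fun_mul hc) hd, pd_mul _ hc hc, pd_coord, pd_inr_comp_ambientProj hU hf hp]
  simp

theorem hasBlockChristoffel_ambientMetric (hM : IsMetricFamily U M) :
    HasBlockChristoffel (ambientDomain U) (ambientMetric fun r z => M (r, z))
      (fun c a b q => if c = 1 ∧ a ≠ b then (q (.inl 0))⁻¹ else 0)
      (fun c A B q => if c = 0
        then -(1 / 2) * (q (.inl 0) * rhoDeriv (fun z => M z A B) (ambientProj q))
        else -1 * M (ambientProj q) A B +
          q (.inl 1) * rhoDeriv (fun z => M z A B) (ambientProj q))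
      (fun e C B q => if e = 0 then (q (.inl 0))⁻¹ * (1 : Matrix (Fin n) (Fin n) ℝ) C B
        else 1 / 2 * logDeriv M C B (ambientProj q))
      (fun C A B q => fiberChristoffel M C A B (ambientProj q)) := by
  have hU := hM.isOpen
  have ha : ∀ (k : Fin 2 ⊕ Fin n) (c d : Fin 2) (q : Fin 2 ⊕ Fin n → ℝ),
      pd k (fun z : Fin 2 ⊕ Fin n → ℝ =>
        (!![2 * z (.inl 1), z (.inl 0); z (.inl 0), 0] : Matrix (Fin 2) (Fin 2) ℝ) c d) q =
      (!![2 * (if Sum.inl 1 = k then 1 else 0), (if Sum.inl 0 = k then 1 else 0);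
        (if Sum.inl 0 = k then 1 else 0), 0] : Matrix (Fin 2) (Fin 2) ℝ) c d := by
    intro k c d q
    have h1 : pd k (fun z : Fin 2 ⊕ Fin n → ℝ => 2 * z (.inl 1)) q =
        2 * (if Sum.inl 1 = k then 1 else 0) := by
      rw [pd_const_mul _ _ (by fun_prop), pd_coord]
    fin_cases c <;> fin_cases d <;> simp [pd_coord, pd_const, h1]
  refine (hasBlockChristoffel_fromBlocks
    (a := fun q => !![2 * q (.inl 1), q (.inl 0); q (.inl 0), 0])
    -- The inverse of the `(t, ρ)` block, whose determinant is `-t²`.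
    (b := fun q => !![0, (q (.inl 0))⁻¹; (q (.inl 0))⁻¹, -2 * q (.inl 1) * (q (.inl 0))⁻¹ ^ 2])
    (m := fun q => q (.inl 0) ^ 2 • M (ambientProj q))
    (i := fun q => (q (.inl 0))⁻¹ ^ 2 • (M (ambientProj q))⁻¹) (fun q => rfl)
    (fun q hq => ?_) (fun q hq => ?_) (fun q _ A c d => ?_)).congr ?_ ?_ ?_ ?_
  · have := hq.1
    ext i j; fin_cases i <;> fin_cases j <;> simp [this]
    field_simp; ring
  · rw [Matrix.smul_mul, Matrix.mul_smul, hM.mul_inv hq.2, smul_smul, ← mul_pow,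
      mul_inv_cancel₀ hq.1, one_pow, one_smul]
  · rw [ha]; fin_cases c <;> fin_cases d <;> simp
  · intro q hq c a b
    simp only [ha]
    fin_cases c <;> fin_cases a <;> fin_cases b <;> simp
    all_goals first | exact Or.inr (by ring) | ring
  · intro q hq c A B
    simp only [Matrix.smul_apply, smul_eq_mul,
      pd_inl_sq_mul_comp_ambientProj hU (hM.smooth A B) hq]
    have := hq.1
    fin_cases c <;> simp <;> field_simp
    ring
  · intro q hq e C B
    simp only [Matrix.smul_apply, smul_eq_mul,
      fun D => pd_inl_sq_mul_comp_ambientProj hU (hM.smooth D B) hq]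
    have := hq.1
    fin_cases e
    · have e1 : (1 : Matrix (Fin n) (Fin n) ℝ) C B =
          ∑ D, (M (ambientProj q))⁻¹ C D * M (ambientProj q) D B := by
        rw [← Matrix.mul_apply, hM.inv_mul hq.2]
      simp only [e1, Finset.mul_sum, Fin.zero_eta, if_true]
      exact Finset.sum_congr rfl fun D _ => by field_simp
    · simp only [logDeriv, Finset.mul_sum, Fin.mk_one, one_ne_zero, if_false]
      exact Finset.sum_congr rfl fun D _ => by field_simp
  · intro q hq C A B
    simp only [Matrix.smul_apply, smul_eq_mul,
      fun D E F => pd_inr_sq_mul_comp_ambientProj hU (hM.smooth D E) hq F, fiberChristoffel]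
    have := hq.1
    congr 1
    exact Finset.sum_congr rfl fun D _ => by field_simp

/-- All powers of `t` cancel, as `Γᵗ_AB` carries `t` and `Γᴬ_tB` carries `t⁻¹`. The coefficient `1 -
n/2` of `μ'` is `-½` from `∂_t Γᵗ_AB`, `-½` from `Γ^ρ_ρt Γᵗ_AB`, `-n/2` from the trace of `Γᶜ_tD`,
and `1 + 1` from the quadratic terms `h3` and `h4`. -/
theorem ricci_ambientMetric_inr (hM : IsMetricFamily U M) {p : Fin 2 ⊕ Fin n → ℝ}
    (hp : p ∈ ambientDomain U) (A B : Fin n) :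
    ricci (ambientMetric fun r z => M (r, z)) p (.inr A) (.inr B) =
      ambientRicci M A B (ambientProj p) := by
  have hU := hM.isOpen
  rw [(hasBlockChristoffel_ambientMetric hM).ricci_inr_inr (isOpen_ambientDomain hU) hp]
  have hM' : ContDiffOn ℝ ∞ (rhoDeriv fun z => M z A B) U := (hM.smooth A B).dirDeriv hU (1, 0)
  have dM := (contDiffOn_comp_ambientProj (hM.smooth A B)).differentiableAt_of_isOpen
    (isOpen_ambientDomain hU) hp
  have dM' := (contDiffOn_comp_ambientProj hM').differentiableAt_of_isOpen
    (isOpen_ambientDomain hU) hp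
  have hc : ∀ e : Fin 2, DifferentiableAt ℝ (fun q : Fin 2 ⊕ Fin n → ℝ => q (.inl e)) p :=
    fun e => by fun_prop
  have h0 : pd (.inl 0) (fun q => -(1 / 2) * (q (.inl 0) *
      rhoDeriv (fun z => M z A B) (ambientProj q))) p =
      -(1 / 2) * rhoDeriv (fun z => M z A B) (ambientProj p) := by
    rw [pd_const_mul _ _ ((hc 0).fun_mul dM'), pd_mul _ (hc 0) dM', pd_coord,
      pd_inl_comp_ambientProj hU hM' hp]
    simp
  have h1 : pd (.inl 1) (fun q => -1 * M (ambientProj q) A B +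
      q (.inl 1) * rhoDeriv (fun z => M z A B) (ambientProj q)) p =
      p (.inl 1) * rhoDeriv (rhoDeriv fun z => M z A B) (ambientProj p) := by
    rw [pd_add _ (dM.const_mul _) ((hc 1).fun_mul dM'), pd_const_mul _ _ dM,
      pd_mul _ (hc 1) dM', pd_coord, pd_inl_comp_ambientProj hU hM' hp,
      pd_inl_comp_ambientProj hU (hM.smooth A B) hp]
    simp
  have h2 : ∀ C D E F, pd (.inr F) (fun q => fiberChristoffel M C D E (ambientProj q)) p = _ :=
    fun C D E F => pd_inr_comp_ambientProj hU (hM.contDiffOn_fiberChristoffel C D E) hp F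
  have ht := hp.1
  have e1 := hM.sum_mul_logDeriv hp.2 A B
  have e2 : ∑ D, M (ambientProj p) B D * logDeriv M D A (ambientProj p) =
      rhoDeriv (fun z => M z A B) (ambientProj p) := by
    rw [hM.sum_mul_logDeriv hp.2 B A, hM.rhoDeriv_symm hp.2]
  have e3 := hM.sum_rhoDeriv_mul_logDeriv_symm hp.2 B A
  have h3 : ∑ D, ((-1 * M (ambientProj p) B D +
          p (.inl 1) * rhoDeriv (fun z => M z B D) (ambientProj p)) *
        (1 / 2 * logDeriv M D A (ambientProj p)) +
      1 / 2 * logDeriv M D B (ambientProj p) * (-1 * M (ambientProj p) A D +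
          p (.inl 1) * rhoDeriv (fun z => M z A D) (ambientProj p))) =
      -rhoDeriv (fun z => M z A B) (ambientProj p) + p (.inl 1) *
        ∑ D, rhoDeriv (fun z => M z A D) (ambientProj p) * logDeriv M D B (ambientProj p) := by
    calc _ = -(1 / 2) * (∑ D, M (ambientProj p) B D * logDeriv M D A (ambientProj p)) -
          1 / 2 * (∑ D, M (ambientProj p) A D * logDeriv M D B (ambientProj p)) +
          p (.inl 1) / 2 * ((∑ D, rhoDeriv (fun z => M z B D) (ambientProj p) *
            logDeriv M D A (ambientProj p)) + ∑ D, rhoDeriv (fun z => M z A D) (ambientProj p) *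
            logDeriv M D B (ambientProj p)) := by
          simp only [Finset.mul_sum, ← Finset.sum_add_distrib, ← Finset.sum_sub_distrib]
          exact Finset.sum_congr rfl fun D _ => by ring
      _ = _ := by rw [e1, e2, e3]; ring
  have h4 : ∑ D, (-(1 / 2) * (p (.inl 0) * rhoDeriv (fun z => M z B D) (ambientProj p)) *
        ((p (.inl 0))⁻¹ * (1 : Matrix (Fin n) (Fin n) ℝ) D A) +
      (p (.inl 0))⁻¹ * (1 : Matrix (Fin n) (Fin n) ℝ) D B *
        (-(1 / 2) * (p (.inl 0) * rhoDeriv (fun z => M z A D) (ambientProj p)))) =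
      -rhoDeriv (fun z => M z A B) (ambientProj p) := by
    simp only [Matrix.one_apply, Finset.sum_add_distrib, mul_ite, ite_mul, mul_one, mul_zero,
      zero_mul, Finset.sum_ite_eq', Finset.mem_univ, if_true]
    rw [hM.rhoDeriv_symm hp.2 B A]
    field_simp
    ring
  have h5 : ∑ C, (1 / 2 * logDeriv M C C (ambientProj p)) =
      1 / 2 * logDerivTrace M (ambientProj p) := by
    simp only [logDerivTrace, Finset.mul_sum]
  have h6 : ∑ C, ((p (.inl 0))⁻¹ * (1 : Matrix (Fin n) (Fin n) ℝ) C C) = n * (p (.inl 0))⁻¹ := by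
    simp
  have e : (ambientProj p).1 = p (.inl 1) := rfl
  simp only [Fin.sum_univ_two, h2, if_true, one_ne_zero, if_false, h0, h1, h3, h4, h5, h6]
  simp only [ambientRicci, fiberRicci, e]
  simp
  field_simp
  ring

/-- Besides `R_AB`, this is the only component entering the scalar curvature: `g^{tt} = 0`, `g^{ρρ}
= -2ρ/t²`, and `R_tρ` vanishes for a straight metric. -/
theorem ricci_ambientMetric_inl_one (hM : IsMetricFamily U M) {p : Fin 2 ⊕ Fin n → ℝ}
    (hp : p ∈ ambientDomain U) :
    ricci (ambientMetric fun r z => M (r, z)) p (.inl 1) (.inl 1) =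
      ambientRicciRho M (ambientProj p) := by
  have hU := hM.isOpen
  have hL : ∀ a C B, ContDiffOn ℝ ∞ (fun q : Fin 2 ⊕ Fin n → ℝ =>
      if a = (0 : Fin 2) then (q (.inl 0))⁻¹ * (1 : Matrix (Fin n) (Fin n) ℝ) C B
        else 1 / 2 * logDeriv M C B (ambientProj q)) (ambientDomain U) := fun a C B => by
    split_ifs
    · exact ((contDiff_apply ℝ ℝ (Sum.inl 0)).contDiffOn.inv fun q hq => hq.1).mul
        contDiffOn_const
    · exact contDiffOn_const.mul (contDiffOn_comp_ambientProj (hM.contDiffOn_logDeriv C B))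
  rw [(hasBlockChristoffel_ambientMetric hM).ricci_inl_inl (isOpen_ambientDomain hU) hL hp]
  have h1 : pd (.inl 1) (fun q => ∑ C, 1 / 2 * logDeriv M C C (ambientProj q)) p =
      1 / 2 * rhoDeriv (logDerivTrace M) (ambientProj p) := by
    have : (fun q => ∑ C, 1 / 2 * logDeriv M C C (ambientProj q)) =
        fun q => 1 / 2 * logDerivTrace M (ambientProj q) := by
      funext q; simp only [logDerivTrace, Finset.mul_sum]
    rw [this, pd_const_mul _ _ ((contDiffOn_comp_ambientProj
      hM.contDiffOn_logDerivTrace).differentiableAt_of_isOpen (isOpen_ambientDomain hU) hp),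
      pd_inl_comp_ambientProj hU hM.contDiffOn_logDerivTrace hp]
    simp
  have h2 : ∑ C, ∑ D, 1 / 2 * logDeriv M C D (ambientProj p) *
      (1 / 2 * logDeriv M D C (ambientProj p)) =
      1 / 4 * ∑ C, ∑ D, logDeriv M C D (ambientProj p) * logDeriv M D C (ambientProj p) := by
    simp only [Finset.mul_sum]
    exact Finset.sum_congr rfl fun C _ => Finset.sum_congr rfl fun D _ => by ring
  simp only [Fin.sum_univ_two, one_ne_zero, if_false, h1, h2]
  simp [pd_zero, ambientRicciRho]

end AmbientRicci

/-! ### Trace and trace-free part -/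

section Trace

variable {n : ℕ} (h X Y : Matrix (Fin n) (Fin n) ℝ) (c : ℝ)

theorem tr_sub : tr h (X - Y) = tr h X - tr h Y := by
  simp [tr, mul_sub, Finset.sum_sub_distrib]

theorem tr_add : tr h (X + Y) = tr h X + tr h Y := by
  simp [tr, mul_add, Finset.sum_add_distrib]

theorem tr_smul : tr h (c • X) = c * tr h X := by
  simp only [tr, Finset.mul_sum, Matrix.smul_apply, smul_eq_mul]
  exact Finset.sum_congr rfl fun _ _ => Finset.sum_congr rfl fun _ _ => by ring

theorem TF_smul : TF h (c • X) = c • TF h X := by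
  rw [TF, TF, tr_smul, smul_sub, smul_smul, mul_div_assoc]

variable {h}

theorem TF_sub_smul_self (hn : n ≠ 0) (hh : tr h h = n) : TF h (X - c • h) = TF h X := by
  have h0 : (n : ℝ) ≠ 0 := by exact_mod_cast hn
  rw [TF, TF, tr_sub, tr_smul, hh, sub_div, mul_div_assoc, div_self h0, mul_one, sub_smul]
  abel

/-- `nextCoeff` solves the linear equation defining the next Taylor coefficient. -/
theorem eq_nextCoeff {m : ℕ} (hm : 2 * (m + 1) < n) (hh : tr h h = n)
    {L : Matrix (Fin n) (Fin n) ℝ}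
    (hX : L + ((m + 1 - (n : ℝ) / 2) • X - (1 / 2 * tr h X) • h) = 0) : X = nextCoeff m h L := by
  have hm' : 2 * ((m : ℝ) + 1) < n := by exact_mod_cast hm
  have hm0 : (0 : ℝ) ≤ m := m.cast_nonneg
  have h1 : (n : ℝ) / 2 - m - 1 ≠ 0 := by linarith
  have h2 : (n : ℝ) - m - 1 ≠ 0 := by linarith
  -- The trace of the equation determines `tr X = tr L / (n - m - 1)`; then the equation itself
  -- determines `X`, its factor `m + 1 - n/2` being nonzero.
  have ht := congrArg (tr h) hX
  rw [tr_add, tr_sub, tr_smul, tr_smul, hh, show tr h 0 = 0 by simp [tr]] at ht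
  have ht' : tr h L = (n - m - 1) * tr h X := by linear_combination ht
  ext A B
  have e := congrFun (congrFun hX A) B
  simp only [Matrix.add_apply, Matrix.sub_apply, Matrix.smul_apply, smul_eq_mul,
    Matrix.zero_apply] at e
  simp only [nextCoeff, Matrix.sub_apply, Matrix.smul_apply, smul_eq_mul, ht']
  have e' : (n - m - 1) * tr h X / (2 * ((n : ℝ) - m - 1)) = tr h X / 2 := by field_simp
  rw [e', one_div, eq_comm, inv_mul_eq_iff_eq_mul₀ h1]
  linear_combination e

end Trace

/-! ### The expansion of a family solving the Einstein equations -/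

section Expansion

variable {n : ℕ} {U : Set (ℝ × (Fin n → ℝ))} {M N : ℝ × (Fin n → ℝ) → Matrix (Fin n) (Fin n) ℝ}

theorem IsMetricFamily.tr_self (hM : IsMetricFamily U M) {x} (hx : x ∈ U) :
    tr (M x) (M x) = n := hM.sum_inv_mul hx

theorem pt_mem_ambientDomain {ρ : ℝ} {y : Fin n → ℝ} (h : (ρ, y) ∈ U) :
    pt 1 ρ y ∈ ambientDomain U := ⟨by simp [pt], h⟩

theorem eventually_mem_of_isOpen (hU : IsOpen U) {y : Fin n → ℝ} {c : ℝ} (hy : (c * 0, y) ∈ U) :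
    ∀ᶠ r in nhds (0 : ℝ), (c * r, y) ∈ U :=
  (hU.preimage (f := fun r : ℝ => (c * r, y)) (by fun_prop)).mem_nhds hy

theorem iteratedDeriv_ricci_ambientMetric_inr (hM : IsMetricFamily U M) {y : Fin n → ℝ}
    (hy : (0, y) ∈ U) (m : ℕ) (A B : Fin n) :
    iteratedDeriv m
      (fun ρ => ricci (ambientMetric fun r z => M (r, z)) (pt 1 ρ y) (.inr A) (.inr B)) 0 =
      rhoDeriv^[m] (ambientRicci M A B) (0, y) := by
  rw [← iteratedDeriv_eq_rhoDeriv_iterate hM.isOpen (hM.contDiffOn_ambientRicci A B) m hy]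
  refine Filter.EventuallyEq.iteratedDeriv_eq m ?_
  filter_upwards [eventually_mem_of_isOpen hM.isOpen (c := 1) (by simpa using hy)] with ρ hρ
  exact ricci_ambientMetric_inr hM (pt_mem_ambientDomain (by simpa using hρ)) A B

theorem iteratedDeriv_ricci_ambientMetric_rho (hM : IsMetricFamily U M) {y : Fin n → ℝ}
    (hy : (0, y) ∈ U) (m : ℕ) :
    iteratedDeriv m
      (fun ρ => ricci (ambientMetric fun r z => M (r, z)) (pt 1 ρ y) (.inl 1) (.inl 1)) 0 =
      rhoDeriv^[m] (ambientRicciRho M) (0, y) := by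
  rw [← iteratedDeriv_eq_rhoDeriv_iterate hM.isOpen hM.contDiffOn_ambientRicciRho m hy]
  refine Filter.EventuallyEq.iteratedDeriv_eq m ?_
  filter_upwards [eventually_mem_of_isOpen hM.isOpen (c := 1) (by simpa using hy)] with ρ hρ
  exact ricci_ambientMetric_inl_one hM (pt_mem_ambientDomain (by simpa using hρ))

/-- `N` is the Taylor polynomial of degree `m` of `M` in `ρ`. -/
def IsTaylorPoly (U : Set (ℝ × (Fin n → ℝ))) (M : ℝ × (Fin n → ℝ) → Matrix (Fin n) (Fin n) ℝ)
    (m : ℕ) (N : ℝ × (Fin n → ℝ) → Matrix (Fin n) (Fin n) ℝ) : Prop :=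
  ∀ x : ℝ × (Fin n → ℝ), (0, x.2) ∈ U → ∀ A B, N x A B =
    ∑ k ∈ Finset.range (m + 1), x.1 ^ k / k.factorial * rhoDeriv^[k] (fun z => M z A B) (0, x.2)

namespace IsTaylorPoly

variable {m : ℕ}

theorem apply_zero (hN : IsTaylorPoly U M m N) {y : Fin n → ℝ} (hy : (0, y) ∈ U) :
    N (0, y) = M (0, y) := by
  ext A B
  rw [hN (0, y) hy, Finset.sum_range_succ']
  simp

theorem isOpen_base (hU : IsOpen U) : IsOpen {x : ℝ × (Fin n → ℝ) | (0, x.2) ∈ U} :=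
  hU.preimage (f := fun x : ℝ × (Fin n → ℝ) => ((0 : ℝ), x.2)) (by fun_prop)

theorem contDiffOn (hM : IsMetricFamily U M) (hN : IsTaylorPoly U M m N) (A B : Fin n) :
    ContDiffOn ℝ ∞ (fun x => N x A B) {x | (0, x.2) ∈ U} := by
  have hc : ContDiff ℝ ∞ (fun x : ℝ × (Fin n → ℝ) => ((0 : ℝ), x.2)) := by fun_prop
  refine ContDiffOn.congr (ContDiffOn.sum (s := Finset.range (m + 1)) fun k _ => ?_)
    fun x hx => hN x hx A B
  exact (((contDiff_fst.pow k).div_const _).contDiffOn).mul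
    (((hM.smooth A B).dirDeriv_iterate hM.isOpen (1, 0) k).comp hc.contDiffOn fun x hx => hx)

theorem rhoDeriv_iterate (hM : IsMetricFamily U M) (hN : IsTaylorPoly U M m N)
    {y : Fin n → ℝ} (hy : (0, y) ∈ U) (j : ℕ) (A B : Fin n) :
    rhoDeriv^[j] (fun x => N x A B) (0, y) =
      if j < m + 1 then rhoDeriv^[j] (fun x => M x A B) (0, y) else 0 := by
  rw [← iteratedDeriv_eq_rhoDeriv_iterate (isOpen_base hM.isOpen) (hN.contDiffOn hM A B) j hy]
  simp only [fun r : ℝ => hN (r, y) hy A B]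
  rw [iteratedDeriv_fun_sum fun k _ => by fun_prop]
  have key : ∀ k, iteratedDeriv j (fun r : ℝ => r ^ k / k.factorial *
      rhoDeriv^[k] (fun x => M x A B) (0, y)) 0 =
      if j = k then rhoDeriv^[k] (fun x => M x A B) (0, y) else 0 := fun k => by
    have e : (fun r : ℝ => r ^ k / k.factorial * rhoDeriv^[k] (fun x => M x A B) (0, y)) =
        fun r => (rhoDeriv^[k] (fun x => M x A B) (0, y) / k.factorial) * r ^ k := by
      funext r; ring
    rw [e, iteratedDeriv_const_mul_field, iteratedDeriv_pow]
    have hk : (k.factorial : ℝ) ≠ 0 := by exact_mod_cast k.factorial_ne_zero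
    rcases lt_trichotomy j k with h | h | h
    · simp [h.ne, Nat.sub_ne_zero_of_lt h]
    · subst h; simp [Nat.descFactorial_self]; field_simp
    · simp [h.ne', Nat.descFactorial_eq_zero_iff_lt.2 h]
  simp only [key, Finset.sum_ite_eq, Finset.mem_range]

/-- The set on which the Taylor polynomial is a smooth family of metrics. -/
def domain (U : Set (ℝ × (Fin n → ℝ))) (N : ℝ × (Fin n → ℝ) → Matrix (Fin n) (Fin n) ℝ) :
    Set (ℝ × (Fin n → ℝ)) := U ∩ {x | (0, x.2) ∈ U ∧ (N x).det ≠ 0}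

theorem zero_mem_domain (hM : IsMetricFamily U M) (hN : IsTaylorPoly U M m N) {y : Fin n → ℝ}
    (hy : (0, y) ∈ U) : (0, y) ∈ domain U N :=
  ⟨hy, hy, by rw [hN.apply_zero hy]; exact hM.det_ne_zero _ hy⟩

/-- The polynomial may degenerate away from `ρ = 0`, hence the smaller domain; it still contains the
slice, where all derivatives are taken. -/
theorem isMetricFamily (hM : IsMetricFamily U M) (hN : IsTaylorPoly U M m N) :
    IsMetricFamily (domain U N) N where
  isOpen := hM.isOpen.inter ((contDiffOn_det (hN.contDiffOn hM)).continuousOn.isOpen_inter_preimage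
    (isOpen_base hM.isOpen) isOpen_ne)
  smooth A B := (hN.contDiffOn hM A B).mono fun _ hx => hx.2.1
  symm x hx A B := by
    rw [hN x hx.2.1, hN x hx.2.1]
    refine Finset.sum_congr rfl fun k _ => ?_
    rw [dirDeriv_iterate_congr hM.isOpen (fun z hz => hM.symm z hz A B) _ k hx.2.1]
  det_ne_zero x hx := hx.2.2

/-- The contribution of the coefficient of order `m + 1` to `∂_ρ^m R_AB` at `ρ = 0`. -/
theorem rhoDeriv_iterate_ambientRicci (hM : IsMetricFamily U M) (hN : IsTaylorPoly U M m N)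
    {y : Fin n → ℝ} (hy : (0, y) ∈ U) :
    Matrix.of (fun A B => rhoDeriv^[m] (ambientRicci M A B) (0, y)) =
      ricciJet (fun r z => N (r, z)) m y +
        ((m + 1 - (n : ℝ) / 2) •
          Matrix.of (fun A B => rhoDeriv^[m + 1] (fun x => M x A B) (0, y)) -
        (1 / 2 * tr (M (0, y)) (Matrix.of fun A B => rhoDeriv^[m + 1] (fun x => M x A B) (0, y))) •
          M (0, y)) := by
  have hN' := hN.isMetricFamily hM
  have hM' := hM.mono hN'.isOpen (Set.inter_subset_left (t := _))
  have hy' := hN.zero_mem_domain hM hy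
  have ag : ∀ A B, AgreeTo (domain U N) (m + 1) (fun x => M x A B) (fun x => N x A B) :=
    fun A B => ⟨hM'.smooth A B, hN'.smooth A B, fun j hj z hz => by
      rw [hN.rhoDeriv_iterate hM hz.1, if_pos hj]⟩
  ext A B
  have key := hM'.rhoDeriv_iterate_ambientRicci_sub hN' ag hy' A B
  -- The Taylor polynomial has degree `m`, so its derivative of order `m + 1` is zero and the
  -- difference of the top coefficients is that of `M` alone.
  simp only [hN.rhoDeriv_iterate hM hy, lt_irrefl, if_false, sub_zero] at key
  have e1 : ricciJet (fun r z => N (r, z)) m y A B =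
      rhoDeriv^[m] (ambientRicci N A B) (0, y) :=
    iteratedDeriv_ricci_ambientMetric_inr hN' hy' m A B
  have e2 : tr (M (0, y)) (Matrix.of fun A B => rhoDeriv^[m + 1] (fun x => M x A B) (0, y)) =
      ∑ C, ∑ D, (M (0, y))⁻¹ C D * rhoDeriv^[m + 1] (fun x => M x D C) (0, y) := by
    simp only [tr, Matrix.of_apply]
    refine Finset.sum_congr rfl fun C _ => Finset.sum_congr rfl fun D _ => ?_
    rw [dirDeriv_iterate_congr hM.isOpen (fun z hz => hM.symm z hz C D) _ (m + 1) hy]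
  simp only [Matrix.of_apply, Matrix.add_apply, Matrix.sub_apply, Matrix.smul_apply, smul_eq_mul,
    e1, e2]
  linear_combination key

end IsTaylorPoly

/-- For a family whose ambient metric solves the Einstein equations up to the order `k - 1`, the
formal expansion determined by the initial metric is the Taylor polynomial of the family. -/
theorem isTaylorPoly_expansion (hM : IsMetricFamily U M) {k : ℕ} (hk : 2 * k < n)
    (hR : ∀ j < k, ∀ y, (0, y) ∈ U → ∀ A B, rhoDeriv^[j] (ambientRicci M A B) (0, y) = 0)
    (m : ℕ) (hm : m ≤ k) :
    IsTaylorPoly U M m (fun x => expansion (fun z => M (0, z)) m x.1 x.2) := by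
  induction m with
  | zero => intro x _ A B; simp [expansion]
  | succ m ih =>
    have ih' := ih (by omega)
    intro x hx A B
    have key := ih'.rhoDeriv_iterate_ambientRicci hM hx
    have e0 : Matrix.of (fun A B => rhoDeriv^[m] (ambientRicci M A B) (0, x.2)) =
        (0 : Matrix (Fin n) (Fin n) ℝ) := by
      ext A B; exact hR m (by omega) _ hx A B
    rw [e0] at key
    -- With `∂_ρ^m R_AB = 0`, the relation `key` is the linear equation for the next coefficient,
    -- and uniqueness of its solution identifies the derivative of `M`.
    have e1 := eq_nextCoeff _ (by omega) (hM.tr_self hx) key.symm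
    rw [Finset.sum_range_succ, ← ih' x hx A B]
    have e2 := congrFun (congrFun e1 A) B
    simp only [Matrix.of_apply] at e2
    simp only [expansion, Matrix.add_apply, Matrix.smul_apply, smul_eq_mul, e2]

/-- The obstruction tensor is the trace-free part of the first unconstrained `ρ`-derivative of the
Ricci tensor. -/
theorem obstruction_eq_TF (hM : IsMetricFamily U M) {k : ℕ} (hn : n = 2 * (k + 1))
    (hR : ∀ j < k, ∀ y, (0, y) ∈ U → ∀ A B, rhoDeriv^[j] (ambientRicci M A B) (0, y) = 0)
    {y : Fin n → ℝ} (hy : (0, y) ∈ U) :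
    obstruction (fun z => M (0, z)) y =
      TF (M (0, y)) (Matrix.of fun A B => rhoDeriv^[k] (ambientRicci M A B) (0, y)) := by
  have hT := isTaylorPoly_expansion hM (k := k) (by omega) hR k le_rfl
  have hk : n / 2 - 1 = k := by omega
  -- At the critical order the coefficient of the unknown tensor is zero. Only its trace times `M
  -- (0, y)` remains, and `TF` removes that.
  have hc : (k : ℝ) + 1 - n / 2 = 0 := by rw [hn]; push_cast; ring
  rw [hT.rhoDeriv_iterate_ambientRicci hM hy, hc, zero_smul, zero_sub, ← sub_eq_add_neg,
    TF_sub_smul_self _ _ (by omega) (hM.tr_self hy), obstruction, hk]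

end Expansion

/-! ### Jets at null infinity -/

section Jets

variable {n : ℕ} {U : Set (ℝ × (Fin n → ℝ))} {M : ℝ × (Fin n → ℝ) → Matrix (Fin n) (Fin n) ℝ}

theorem iteratedDeriv_comp_mul_eq (hU : IsOpen U) {f : ℝ × (Fin n → ℝ) → ℝ}
    (hf : ContDiffOn ℝ ∞ f U) (k : ℕ) (u : ℝ) {v : ℝ} {y : Fin n → ℝ} (hx : (u * v, y) ∈ U) :
    iteratedDeriv k (fun r => f (u * r, y)) v = u ^ k * rhoDeriv^[k] f (u * v, y) := by
  induction k generalizing v with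
  | zero => simp
  | succ k ih =>
    rw [iteratedDeriv_succ, Function.iterate_succ_apply']
    have hO : IsOpen {r : ℝ | (u * r, y) ∈ U} := hU.preimage (by fun_prop)
    have he : iteratedDeriv k (fun r => f (u * r, y)) =ᶠ[nhds v]
        fun r => u ^ k * rhoDeriv^[k] f (u * r, y) :=
      Filter.eventuallyEq_of_mem (hO.mem_nhds hx) fun r hr => ih hr
    rw [he.deriv_eq]
    have hd := (hf.dirDeriv_iterate hU (1, 0) k).differentiableAt_of_isOpen hU hx
    have hg : HasDerivAt (fun r : ℝ => ((u * r, y) : ℝ × (Fin n → ℝ))) (u • (1, 0)) v := by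
      simpa using ((hasDerivAt_id v).const_mul u).prodMk (hasDerivAt_const v y)
    refine ((hd.hasFDerivAt.comp_hasDerivAt v hg).const_mul (u ^ k)).deriv.trans ?_
    rw [map_smul, smul_eq_mul, pow_succ, mul_assoc]
    rfl

/-- In the Leibniz rule at `v = 0` exactly one of the `k + 1` derivatives must fall on the factor
`v`; each of the others produces a factor `u`. -/
theorem iteratedDeriv_id_mul_comp_mul (hU : IsOpen U) {f : ℝ × (Fin n → ℝ) → ℝ}
    (hf : ContDiffOn ℝ ∞ f U) (k : ℕ) (u : ℝ) {y : Fin n → ℝ} (hy : (0, y) ∈ U) :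
    iteratedDeriv (k + 1) (fun v => v * f (u * v, y)) 0 =
      (k + 1) * (u ^ k * rhoDeriv^[k] f (0, y)) := by
  have hy' : (u * 0, y) ∈ U := by simpa using hy
  have hc : ContDiff ℝ ∞ (fun r : ℝ => ((u * r, y) : ℝ × (Fin n → ℝ))) := by fun_prop
  have hg : ContDiffAt ℝ (k + 1 : ℕ) (fun v => f (u * v, y)) 0 :=
    ((hf.contDiffAt (hU.mem_nhds hy')).comp (0 : ℝ) hc.contDiffAt).of_le
      (by exact_mod_cast le_top)
  rw [iteratedDeriv_fun_mul contDiffAt_fun_id hg]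
  have h1 : ∀ i, iteratedDeriv i (fun x : ℝ => x) 0 = if i = 1 then 1 else 0 := fun i => by
    have := iteratedDeriv_pow (𝕜 := ℝ) (x := 0) 1 i
    simp only [pow_one] at this
    rw [this]
    rcases i with _ | _ | i
    · simp
    · simp
    · simp
  simp only [h1, mul_ite, ite_mul, mul_one, mul_zero, zero_mul, Finset.sum_ite_eq',
    Finset.mem_range]
  rw [if_pos (by omega), Nat.choose_one_right, Nat.add_sub_cancel,
    iteratedDeriv_comp_mul_eq hU hf k u hy', mul_zero]
  push_cast; ring

theorem rhoDeriv_iterate_zero (k : ℕ) :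
    rhoDeriv^[k] (fun _ : ℝ × (Fin n → ℝ) => (0 : ℝ)) = fun _ => 0 := by
  induction k with
  | zero => rfl
  | succ k ih =>
    rw [Function.iterate_succ_apply, show rhoDeriv (fun _ : ℝ × (Fin n → ℝ) => (0 : ℝ)) = _ from
      dirDeriv_const _ 0, ih]

theorem contDiffOn_ambientScal (hM : IsMetricFamily U M) : ContDiffOn ℝ ∞ (ambientScal M) U := by
  refine ContDiffOn.sub (ContDiffOn.sum fun A _ => ContDiffOn.sum fun B _ => ?_) ?_
  · exact (contDiffOn_inv hM.smooth hM.det_ne_zero A B).mul (hM.contDiffOn_ambientRicci A B)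
  · exact contDiffOn_const.mul (contDiffOn_rho.mul hM.contDiffOn_ambientRicciRho)

/-- The Ricci tensor of the ambient metric of `M` vanishes to the order `k` at `ρ = 0`. -/
structure IsRicciFlatTo (U : Set (ℝ × (Fin n → ℝ)))
    (M : ℝ × (Fin n → ℝ) → Matrix (Fin n) (Fin n) ℝ) (k : ℕ) : Prop where
  tangential : ∀ j < k, ∀ y, (0, y) ∈ U → ∀ A B, rhoDeriv^[j] (ambientRicci M A B) (0, y) = 0
  rho : ∀ j < k, ∀ y, (0, y) ∈ U → rhoDeriv^[j] (ambientRicciRho M) (0, y) = 0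

theorem IsRicciFlatTo.agreeTo_ambientScal (hM : IsMetricFamily U M) {k : ℕ}
    (hR : IsRicciFlatTo U M k) : AgreeTo U k (ambientScal M) (fun _ => 0) := by
  have hU := hM.isOpen
  have hF : ∀ A B, AgreeTo U k (ambientRicci M A B) (fun _ => 0) := fun A B =>
    ⟨hM.contDiffOn_ambientRicci A B, contDiffOn_const, fun j hj y hy => by
      rw [hR.tangential j hj y hy, rhoDeriv_iterate_zero]⟩
  have hP : AgreeTo U k (ambientRicciRho M) (fun _ => 0) :=
    ⟨hM.contDiffOn_ambientRicciRho, contDiffOn_const, fun j hj y hy => by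
      rw [hR.rho j hj y hy, rhoDeriv_iterate_zero]⟩
  refine ((AgreeTo.sum hU fun A _ => AgreeTo.sum hU fun B _ =>
    (AgreeTo.refl (contDiffOn_inv hM.smooth hM.det_ne_zero A B)).mul hU (hF A B)).sub hU
    (((AgreeTo.refl contDiffOn_rho).mul hU hP).const_mul hU 2)).congr hU (fun x _ => rfl)
    (fun x _ => by simp)

/-- The value at null infinity of the `v`-derivative of order `k + 1` of
`v (R_AB - c Scal μ_AB) / n`. -/
theorem IsRicciFlatTo.iteratedDeriv_eq (hM : IsMetricFamily U M) {k : ℕ}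
    (hn : n = 2 * (k + 1)) (hR : IsRicciFlatTo U M k) (c u : ℝ) {y : Fin n → ℝ} (hy : (0, y) ∈ U)
    {F : (Fin 2 ⊕ Fin n → ℝ) → Matrix (Fin 2 ⊕ Fin n) (Fin 2 ⊕ Fin n) ℝ}
    (hF : ∀ p, conformalProj p ∈ U → ∀ A B : Fin n, F p (.inr A) (.inr B) =
      p (.inl 1) * (1 / n * (ambientRicci M A B (conformalProj p) -
        c * (ambientScal M (conformalProj p) * M (conformalProj p) A B)))) :
    Matrix.of (fun A B => iteratedDeriv (k + 1)
        (fun v => F (pt u v y) (.inr A) (.inr B)) 0) =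
      (1 / 2 * u ^ k) • (Matrix.of (fun A B => rhoDeriv^[k] (ambientRicci M A B) (0, y)) -
        (c * rhoDeriv^[k] (ambientScal M) (0, y)) • M (0, y)) := by
  have hU := hM.isOpen
  ext A B
  have s1 := hM.contDiffOn_ambientRicci A B
  have s2 : ContDiffOn ℝ ∞ (fun x => M x A B * ambientScal M x) U :=
    (hM.smooth A B).mul (contDiffOn_ambientScal hM)
  have s3 : ContDiffOn ℝ ∞ (fun x => c * (M x A B * ambientScal M x)) U := contDiffOn_const.mul s2
  have s4 : ContDiffOn ℝ ∞ (fun x => ambientRicci M A B x - c * (M x A B * ambientScal M x)) U :=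
    s1.sub s3
  have s5 : ContDiffOn ℝ ∞
      (fun x => 1 / (n : ℝ) * (ambientRicci M A B x - c * (M x A B * ambientScal M x))) U :=
    contDiffOn_const.mul s4
  have e : (fun v => F (pt u v y) (.inr A) (.inr B)) =ᶠ[nhds 0]
      fun v => v * (1 / (n : ℝ) * (ambientRicci M A B (u * v, y) -
        c * (M (u * v, y) A B * ambientScal M (u * v, y)))) := by
    filter_upwards [eventually_mem_of_isOpen hU (c := u) (by simpa using hy)] with v hv
    rw [hF (pt u v y) hv, mul_comm (ambientScal M _)]
    rfl
  have h1 := iteratedDeriv_id_mul_comp_mul hU s5 k u hy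
  have h2 := rhoDeriv_iterate_const_mul hU s4 (1 / (n : ℝ)) k hy
  have h3 := rhoDeriv_iterate_sub hU s1 s3 k hy
  have h4 := rhoDeriv_iterate_const_mul hU s2 c k hy
  -- `Scal` agrees with `0` to orders `< k`, so in `∂_ρ^k (μ_AB Scal)` only the term with all
  -- derivatives on `Scal` is left, a multiple of `M (0, y)`.
  have h5 := AgreeTo.rhoDeriv_iterate_mul_sub hU (AgreeTo.refl (hM.smooth A B))
    (hR.agreeTo_ambientScal hM) hy
  have h6 : rhoDeriv^[k] (fun x => M x A B * 0) (0, y) = 0 := by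
    simp only [mul_zero, rhoDeriv_iterate_zero]
  rw [rhoDeriv_iterate_zero, h6, sub_zero, sub_zero] at h5
  simp only at h2 h3 h4
  rw [h2, h3, h4, h5] at h1
  -- The factor `k + 1` from differentiating `v` and the `1/n` of the Schouten tensor combine to
  -- `½`.
  have hk : (n : ℝ) = 2 * (k + 1) := by rw [hn]; push_cast; ring
  have hk0 : (k : ℝ) + 1 ≠ 0 := by positivity
  simp only [Matrix.of_apply, Matrix.smul_apply, Matrix.sub_apply, smul_eq_mul]
  rw [e.iteratedDeriv_eq, h1, hk]
  field_simp

end Jets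

/-! ### Families of bilinear forms in a chart -/

section Chart

variable {n : ℕ} {S : Type*} [TopologicalSpace S]

/-- The set of the pairs `(ρ, y)` which correspond to points of `W` in the chart `e`. -/
def chartDomain (e : OpenPartialHomeomorph S (Fin n → ℝ)) (W : Set (ℝ × S)) :
    Set (ℝ × (Fin n → ℝ)) :=
  {q | q.2 ∈ e.target ∧ (q.1, e.symm q.2) ∈ W}

theorem isOpen_chartDomain (e : OpenPartialHomeomorph S (Fin n → ℝ)) {W : Set (ℝ × S)}
    (hW : IsOpen W) : IsOpen (chartDomain e W) := by
  have hc : ContinuousOn (fun q : ℝ × (Fin n → ℝ) => (q.1, e.symm q.2))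
      {q | q.2 ∈ e.target} :=
    continuousOn_fst.prodMk (e.continuousOn_symm.comp continuousOn_snd fun q hq => hq)
  exact hc.isOpen_inter_preimage (e.open_target.preimage continuous_snd) hW

variable [ChartedSpace (Fin n → ℝ) S]

/-- A null vector of the component matrix is carried by the derivative of the inverse chart to a
vector in the radical of `b`, which is zero. That derivative is invertible with inverse `D'`, so the
null vector is zero as well. -/
theorem det_components_ne_zero [IsManifold 𝓘(ℝ, Fin n → ℝ) ∞ S]
    {e : OpenPartialHomeomorph S (Fin n → ℝ)}
    (he : e ∈ IsManifold.maximalAtlas 𝓘(ℝ, Fin n → ℝ) ∞ S) {b : BilinField n S} {y : Fin n → ℝ}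
    (hy : y ∈ e.target) (hb : ∀ X, (∀ Y, b (e.symm y) X Y = 0) → X = 0) :
    (components e b y).det ≠ 0 := by
  intro hdet
  obtain ⟨v, hv, hv0⟩ := Matrix.exists_vecMul_eq_zero_iff.2 hdet
  have hmd : e.MDifferentiable 𝓘(ℝ, Fin n → ℝ) 𝓘(ℝ, Fin n → ℝ) :=
    ⟨(contMDiffOn_of_mem_maximalAtlas he).mdifferentiableOn (by simp),
      (contMDiffOn_symm_of_mem_maximalAtlas he).mdifferentiableOn (by simp)⟩
  set D : (Fin n → ℝ) →L[ℝ] TangentSpace 𝓘(ℝ, Fin n → ℝ) (e.symm y) :=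
    mfderiv 𝓘(ℝ, Fin n → ℝ) 𝓘(ℝ, Fin n → ℝ) e.symm y with hD
  set D' : TangentSpace 𝓘(ℝ, Fin n → ℝ) (e.symm y) →L[ℝ] (Fin n → ℝ) :=
    mfderiv 𝓘(ℝ, Fin n → ℝ) 𝓘(ℝ, Fin n → ℝ) e (e.symm y) with hD'
  have h1 : ∀ w, D' (D w) = w := fun w => DFunLike.congr_fun (hmd.comp_symm_deriv hy) w
  have h2 : ∀ X, D (D' X) = X := fun X => by
    have h := hmd.symm_comp_deriv (e.map_target hy)
    rw [e.right_inv hy] at h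
    exact DFunLike.congr_fun h X
  have hsum : ∀ w : Fin n → ℝ, D w = ∑ A, w A • coordVec e y A := fun w => by
    conv_lhs => rw [pi_eq_sum_univ' w]
    rw [map_sum]
    exact Finset.sum_congr rfl fun A _ => by rw [map_smul]; rfl
  have hX : D v = 0 := hb _ fun Y => by
    rw [← h2 Y, hsum (D' Y), hsum v, map_sum]
    refine Finset.sum_eq_zero fun B _ => ?_
    rw [map_smul, map_sum, sum_apply]
    have := congrFun hv0 B
    simp only [Matrix.vecMul, dotProduct, components, Matrix.of_apply, Pi.zero_apply] at this
    simp only [map_smul, smul_apply, smul_eq_mul, this, mul_zero]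
  exact hv (by rw [← h1 v, hX, map_zero])

theorem IsStraightAmbient.isMetricFamily [IsManifold 𝓘(ℝ, Fin n → ℝ) ∞ S] {h : BilinField n S}
    {W : Set (ℝ × S)} {μ : ℝ → BilinField n S} (hμ : IsStraightAmbient h W μ)
    {e : OpenPartialHomeomorph S (Fin n → ℝ)}
    (he : e ∈ IsManifold.maximalAtlas 𝓘(ℝ, Fin n → ℝ) ∞ S) :
    IsMetricFamily (chartDomain e W) (fun x => components e (μ x.1) x.2) where
  isOpen := isOpen_chartDomain e hμ.isOpen
  smooth := hμ.smooth e he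
  symm _ hx _ _ := hμ.symm _ _ hx.2 _ _
  det_ne_zero _ hx := det_components_ne_zero he hx.1 (hμ.nondegenerate _ _ hx.2)

end Chart

end AmbientNullInfinity

end

/-! ### The obstruction tensor at null infinity over `S` -/

theorem mainTheorem4 {n : ℕ} (hn : Even n) (hn4 : 4 ≤ n)
    {S : Type*} [TopologicalSpace S] [ChartedSpace (Fin n → ℝ) S]
    [IsManifold 𝓘(ℝ, Fin n → ℝ) ∞ S]
    (h : AmbientNullInfinity.BilinField n S) (W : Set (ℝ × S))
    (μ : ℝ → AmbientNullInfinity.BilinField n S)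
    (hμ : AmbientNullInfinity.IsStraightAmbient h W μ)
    (hsolved : AmbientNullInfinity.SolvedToOrder μ (n / 2 - 2))
    (e : OpenPartialHomeomorph S (Fin n → ℝ))
    (he : e ∈ IsManifold.maximalAtlas 𝓘(ℝ, Fin n → ℝ) ∞ S)
    (y : Fin n → ℝ) (hy : y ∈ e.target) :
    (∀ (u : ℝ) (A B : Fin n),
      ((n / 2 - 1).factorial : ℝ) *
          AmbientNullInfinity.obstruction (AmbientNullInfinity.components e h) y A B =
        2 * iteratedDeriv (n / 2 - 1)
          (fun w => AmbientNullInfinity.TF (AmbientNullInfinity.components e h y)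
            (AmbientNullInfinity.QJet (fun r => AmbientNullInfinity.components e (μ r))
              (n / 2) w y) A B) u) ∧
    (AmbientNullInfinity.obstruction (AmbientNullInfinity.components e h) y ≠ 0 →
      ∀ u : ℝ, u ≠ 0 →
        AmbientNullInfinity.TF (AmbientNullInfinity.components e h y)
          (AmbientNullInfinity.QJet (fun r => AmbientNullInfinity.components e (μ r))
            (n / 2) u y) ≠ 0 ∧
        AmbientNullInfinity.QJet (fun r => AmbientNullInfinity.components e (μ r))
          (n / 2) u y ≠ 0 ∧
        AmbientNullInfinity.quasiEinsteinJet (fun r => AmbientNullInfinity.components e (μ r))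
          (n / 2) u y ≠ 0) := by
  open AmbientNullInfinity in
  obtain ⟨k, hk⟩ : ∃ k, n = 2 * (k + 1) := by
    obtain ⟨r, hr⟩ := hn
    exact ⟨r - 1, by omega⟩
  have hn0 : n ≠ 0 := by omega
  have hk1 : n / 2 = k + 1 := by omega
  have hk2 : k + 1 - 1 = k := rfl
  have hM := hμ.isMetricFamily he
  set M : ℝ × (Fin n → ℝ) → Matrix (Fin n) (Fin n) ℝ := fun x => components e (μ x.1) x.2 with hMdef
  have mem : ∀ z, z ∈ e.target → ((0 : ℝ), z) ∈ chartDomain e W := fun z hz => ⟨hz, hμ.zero_mem _⟩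
  have hR : IsRicciFlatTo (chartDomain e W) M k := by
    constructor
    · intro j hj z hz A B
      rw [← iteratedDeriv_ricci_ambientMetric_inr hM hz]
      -- The hypothesis is used at `t = 1`; as `n/2 - 2 = k - 1`, it covers exactly the orders `j <
      -- k`.
      exact hsolved e he z hz.1 1 one_pos j (by omega) _ _
    · intro j hj z hz
      rw [← iteratedDeriv_ricci_ambientMetric_rho hM hz]
      exact hsolved e he z hz.1 1 one_pos j (by omega) _ _
  have h0 : components e h = fun z => M (0, z) := by simp only [hMdef, hμ.initial]
  have hy0 := mem y hy
  have htr := hM.tr_self hy0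
  have hO := obstruction_eq_TF hM hk hR.tangential hy0
  have hQ : ∀ u, TF (M (0, y)) (QJet (fun r => components e (μ r)) (k + 1) u y) =
      (1 / 2 * u ^ k) • obstruction (fun z => M (0, z)) y := fun u => by
    -- The constant `c` is read off from the formula for `𝒬_AB`. Its value is irrelevant, because
    -- its term is a multiple of `M (0, y)` and is killed by `TF`.
    have := hR.iteratedDeriv_eq hM hk _ u hy0 fun p hp => Q_conformalMetric_inr hn0 hM hp
    refine (congrArg (TF (M (0, y))) this).trans ?_
    rw [TF_smul, TF_sub_smul_self _ _ hn0 htr, hO]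
  have hE : ∀ u, TF (M (0, y)) (quasiEinsteinJet (fun r => components e (μ r)) (k + 1) u y) =
      (1 / 2 * u ^ k) • obstruction (fun z => M (0, z)) y := fun u => by
    have := hR.iteratedDeriv_eq hM hk _ u hy0 fun p hp => quasiEinstein_conformalMetric_inr hn0 hM hp
    refine (congrArg (TF (M (0, y))) this).trans ?_
    rw [TF_smul, TF_sub_smul_self _ _ hn0 htr, hO]
  -- A jet that vanished would have zero trace-free part, so nonvanishing of the trace-free part
  -- suffices for both tensors.
  have hTF0 : TF (M (0, y)) 0 = 0 := by simp [TF, tr]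
  rw [h0, hk1, hk2]
  refine ⟨fun u A B => ?_, fun hne u hu => ?_⟩
  · simp only [hQ, Matrix.smul_apply, smul_eq_mul]
    have e1 : (fun w : ℝ => 1 / 2 * w ^ k * obstruction (fun z => M (0, z)) y A B) =
        fun w => 1 / 2 * obstruction (fun z => M (0, z)) y A B * w ^ k := by
      funext w; ring
    -- The `k`-th derivative of `w ^ k` is the constant `k!`, so the identity holds at every `u`,
    -- including `u = 0`.
    rw [e1, iteratedDeriv_const_mul_field, iteratedDeriv_pow, Nat.descFactorial_self]
    simp
    ring
  · have hne' : (1 / 2 * u ^ k) • obstruction (fun z => M (0, z)) y ≠ 0 :=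
      smul_ne_zero (mul_ne_zero (by norm_num) (pow_ne_zero _ hu)) hne
    refine ⟨by rw [hQ]; exact hne', fun hz => hne' ?_, fun hz => hne' ?_⟩
    · rw [← hQ, hz, hTF0]
    · rw [← hE, hz, hTF0]
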